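/- Let $d\ge 2$ and let $P\subset\mathbb R^d$ be a $d$-dimensional polytope (compact finite intersection of half-spaces) with $(d-1)$-dimensional faces $F_1,\dots,F_N$ and interior unit normals $\eta_1,\dots,\eta_N$. Assume that $P$ is *spanning*: there is $\varepsilon>0$ such that for any $d$ distinct faces $F_{i_1},\dots,F_{i_d}$ the angle between $\eta_{i_1}$ and every non-zero vector of $\operatorname{span}(\eta_{i_2},\dots,\eta_{i_d})$ is at least $\varepsilon$. Let $f:[0,\frac\pi2)\to[0,\frac\pi2)$ be a contracting reflection law, i.e. $f$ is $C^2$, $f(0)=0$ and $0<\sup|f'|<1$. For a unit vector $\eta$ and $v\in\mathbb S^+_\eta=\{v:\|v\|=1,\langle v,\eta\rangle>0\}$ put $$C_\eta(v)=\frac{\cos f(\theta)}{\cos\theta}\langle v,\eta\rangle\eta+\frac{\sin f(\theta)}{\sin\theta}\,(v-\langle v,\eta\rangle\eta),\qquad \theta=\arccos\langle v,\eta\rangle ,\qquad C_\eta(\eta)=\eta .$$ Let $M=\bigcup_i F_i^\circ\times\mathbb S^+_{\eta_i}$, where $F_i^\circ$ is the relative interior of $F_i$, and let $M'$ be the set of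 $(p,v)\in M$ such that the half-line $\{p+tv:t\ge0\}$ does not meet the $(d-2)$-skeleton $\bigcup_i(F_i\setminus F_i^\circ)$. The contracting billiard map $\Phi=\Phi_{f,P}:M'\to M$ is $\Phi(p,v)=\big(p',C_{\eta_j}(v-2\langle v,\eta_j\rangle\eta_j)\big)$, where $p'=p+tv\in F_j^\circ$ with $t>0$ minimal. Let $M^+$ be the set of points of $M$ all of whose forward iterates exist and lie in $M'$, and let $D=\bigcap_{n\ge0}\Phi^n(M^+)$. A set $\Lambda$ is *invariant* if $\Lambda\subset D$ and $\Phi^{-1}(\Lambda)=\Lambda$. A point $x\in M^+$ is *$k$-generating* if for any $k$ consecutive points of its forward orbit the normals of the faces containing their base points span $\mathbb R^d$; the *escaping time* $T(x)\in\mathbb N\cup\{\infty\}$ is the least $k\ge1$ such that $x$ is $k$-generating ($\infty$ if there is none). Then there are constants $\sigma>1$, $0<\lambda<1$ and $C>0$, depending only on $f$ and $P$, with the following property. Let $\Lambda$ be an invariant set on which $T$ is bounded and let $\tau\ge1$ be an integer with $T\le\tau$ on $\Lambda$ (in particular $\tau=\sup_\Lambda T$ if $\Lambda\neq\emptyset$).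 Then $\Phi$ is uniformly hyperbolic on $\Lambda$ with expansion rate $\rho=\sigma^{1/\tau}>1$: all iterates $\Phi^n$ are differentiable at the points of $\Lambda$, and there is a splitting $T_xM=E^s(x)\oplus E^{u}(x)$, $x\in\Lambda$, depending continuously on $x\in\Lambda$, such that for all $x\in\Lambda$ $$E^s(x)=D\Phi(x)^{-1}\big(E^s(\Phi(x))\big),\qquad D\Phi(x)(E^{u}(x))=E^{u}(\Phi(x)),$$ where the first means a preimage, and $D\Phi(x)(E^s(x))=E^s(\Phi(x))$ whenever $D\Phi(x)$ is injective on $T_xM$; and for all $x\in\Lambda$ and $n\ge1$ $$\|D\Phi^n(x)y\|\le C\lambda^n\|y\|\ \ (y\in E^s(x)),\qquad \|y\|\le C\rho^{-n}\|D\Phi^n(x)y\|\ \ (y\in E^{u}(x)),$$ the second inequality being $\|D\Phi^{-n}|_{E^u}\|\le C\rho^{-n}$. Here $T_xM\subset\mathbb R^d\times\mathbb R^d$ carries the Euclidean norm. -/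

import Mathlib

open scoped RealInnerProductSpace

noncomputable section

namespace PolytopeBilliard

/-- Euclidean space of dimension `d`. -/
abbrev E (d : ℕ) : Type := EuclideanSpace ℝ (Fin d)

/-- The ambient space of pairs `(p, v)` (and of tangent vectors `(u, w)`), with its Euclidean
structure `‖(u, w)‖ ^ 2 = ‖u‖ ^ 2 + ‖w‖ ^ 2`. -/
abbrev X (d : ℕ) : Type := WithLp 2 (E d × E d)

/-- The intersection of the half-spaces `offset i ≤ ⟪normal i, x⟫`. -/
def halfSpaces {d N : ℕ} (normal : Fin N → E d) (offset : Fin N → ℝ) : Set (E d) :=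
  {x | ∀ i, offset i ≤ ⟪normal i, x⟫}

/-- A `d`-dimensional polytope in `ℝ^d`, given by its `N` faces of dimension `d - 1`: the interior
unit normals and the supporting hyperplanes `⟪normal i, x⟫ = offset i` of the faces. Every
`d`-dimensional compact finite intersection of half-spaces has exactly one such description, up to
the numbering of the faces. -/
structure Polytope (d : ℕ) where
  /-- the number of faces -/
  N : ℕ
  /-- the interior unit normals of the faces -/
  normal : Fin N → E d
  /-- the position of the supporting hyperplanes of the faces -/
  offset : Fin N → ℝ
  norm_normal : ∀ i, ‖normal i‖ = 1
  isCompact : IsCompact (halfSpaces normal offset)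
  interior_nonempty : (interior (halfSpaces normal offset)).Nonempty
  finrank_face : ∀ i, Module.finrank ℝ
    (vectorSpan ℝ {x ∈ halfSpaces normal offset | ⟪normal i, x⟫ = offset i}) + 1 = d
  face_injective : Function.Injective
    (fun i => {x ∈ halfSpaces normal offset | ⟪normal i, x⟫ = offset i})

variable {d : ℕ}

namespace Polytope

/-- The face `F_i`. -/
def face (P : Polytope d) (i : Fin P.N) : Set (E d) :=
  {x ∈ halfSpaces P.normal P.offset | ⟪P.normal i, x⟫ = P.offset i}

/-- The relative interior of the face `F_i`: the points of `F_i` that lie on no other face. -/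
def faceInterior (P : Polytope d) (i : Fin P.N) : Set (E d) :=
  {x ∈ P.face i | ∀ j, j ≠ i → x ∉ P.face j}

/-- The `(d - 2)`-skeleton: the union of the relative boundaries of the faces. -/
def skeleton (P : Polytope d) : Set (E d) :=
  ⋃ i, P.face i \ P.faceInterior i

open Classical in
/-- The interior unit normal of the face in whose relative interior `p` lies (that face is unique;
the value is `0` if there is none). -/
def normalAt (P : Polytope d) (p : E d) : E d :=
  if h : ∃ i, p ∈ P.faceInterior i then P.normal h.choose else 0

/-- For any `d` distinct faces, the angle between the normal of one of them and any non-zero vector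
of the span of the other `d - 1` normals is at least `ε`. -/
def IsSpanningWith (P : Polytope d) (ε : ℝ) : Prop :=
  ∀ J : Finset (Fin P.N), J.card = d → ∀ i ∈ J,
    ∀ u ∈ Submodule.span ℝ (P.normal '' {j | j ∈ J ∧ j ≠ i}), u ≠ 0 →
      ε ≤ InnerProductGeometry.angle (P.normal i) u

/-- A spanning polytope. -/
def IsSpanning (P : Polytope d) : Prop := ∃ ε : ℝ, 0 < ε ∧ P.IsSpanningWith ε

end Polytope

/-- The open hemisphere of unit vectors `v` with `⟪v, η⟫ > 0`. -/
def hemisphere (η : E d) : Set (E d) := {v | ‖v‖ = 1 ∧ 0 < ⟪v, η⟫}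

/-- The reflection about the hyperplane orthogonal to the unit vector `η`. -/
def reflect (η u : E d) : E d := u - (2 * ⟪u, η⟫) • η

/-- The domain `[0, π / 2)` of reflection laws. -/
def angleDomain : Set ℝ := Set.Ico 0 (Real.pi / 2)

/-- A contracting reflection law: a `C^2` map `f : [0, π/2) → [0, π/2)` with `f 0 = 0` and
`0 < sup |f'| < 1`. -/
structure IsContractingReflectionLaw (f : ℝ → ℝ) : Prop where
  mapsTo : Set.MapsTo f angleDomain angleDomain
  contDiffOn : ContDiffOn ℝ 2 f angleDomain
  map_zero : f 0 = 0
  bddAbove : BddAbove ((fun θ => |derivWithin f angleDomain θ|) '' angleDomain)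
  sup_pos : 0 < sSup ((fun θ => |derivWithin f angleDomain θ|) '' angleDomain)
  sup_lt_one : sSup ((fun θ => |derivWithin f angleDomain θ|) '' angleDomain) < 1

/-- The contraction `C_η` of the hemisphere of `η` towards `η` that is defined by `f`:
with `θ = arccos ⟪v, η⟫`, it sends `v` to
`(cos f(θ) / cos θ) P_η(v) + (sin f(θ) / sin θ) P_{η^⊥}(v)`. At `v = η` the second summand
vanishes, because `P_{η^⊥}(η) = 0`, and the value is `η`. -/
def contract (f : ℝ → ℝ) (η v : E d) : E d :=
  (Real.cos (f (Real.arccos ⟪v, η⟫)) / Real.cos (Real.arccos ⟪v, η⟫)) • (⟪v, η⟫ • η) +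
  (Real.sin (f (Real.arccos ⟪v, η⟫)) / Real.sin (Real.arccos ⟪v, η⟫)) • (v - ⟪v, η⟫ • η)

namespace Polytope

variable (P : Polytope d) (f : ℝ → ℝ)

/-- The phase space `M`: pairs `(p, v)` with `p` in the relative interior of a face and `v` a unit
vector pointing inside. -/
def M : Set (X d) := {x | ∃ i, x.fst ∈ P.faceInterior i ∧ x.snd ∈ hemisphere (P.normal i)}

/-- The domain `M'` of the billiard map: the half-line from `p` in direction `v` misses the
skeleton. -/
def M' : Set (X d) := {x ∈ P.M | ∀ t : ℝ, 0 ≤ t → x.fst + t • x.snd ∉ P.skeleton}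

/-- The flight time: the least `t > 0` for which `p + t v` lies in the relative interior of
a face. -/
def flightTime (x : X d) : ℝ :=
  sInf {t : ℝ | 0 < t ∧ ∃ j, x.fst + t • x.snd ∈ P.faceInterior j}

/-- The next collision point `p + τ v`. -/
def nextPoint (x : X d) : E d := x.fst + P.flightTime x • x.snd

/-- The contracting billiard map `Φ_{f,P}` (meaningful on `M'`): fly to the next face, reflect, and
contract towards the normal of that face. -/
def billiardMap (x : X d) : X d :=
  WithLp.toLp 2 (P.nextPoint x,
    contract f (P.normalAt (P.nextPoint x)) (reflect (P.normalAt (P.nextPoint x)) x.snd))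

/-- The points of `M` that can be iterated forward for ever. -/
def MPlus : Set (X d) := {x ∈ P.M | ∀ n : ℕ, (P.billiardMap f)^[n] x ∈ P.M'}

/-- The set `D`, the intersection of the forward images of `M^+`. -/
def D : Set (X d) := ⋂ n : ℕ, (P.billiardMap f)^[n] '' P.MPlus f

/-- Invariant sets: `Λ ⊆ D` and `Φ⁻¹(Λ) = Λ`, where `Φ` has the domain `M'`. -/
def IsInvariant (Λ : Set (X d)) : Prop :=
  Λ ⊆ P.D f ∧ {x ∈ P.M' | P.billiardMap f x ∈ Λ} = Λ

/-- `x` is `k`-generating: the normals of the faces at any `k` consecutive collisions of the orbit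
of `x` span `ℝ^d`. -/
def IsGenerating (k : ℕ) (x : X d) : Prop :=
  ∀ i : ℕ, Submodule.span ℝ
    {n : E d | ∃ m < k, n = P.normalAt ((P.billiardMap f)^[i + m] x).fst} = ⊤

/-- The escaping time: the least positive `k` such that `x` is `k`-generating, and `⊤` if there
is none. -/
def escapingTime (x : X d) : ℕ∞ :=
  ⨅ (k : ℕ) (_ : 1 ≤ k ∧ P.IsGenerating f k x), (k : ℕ∞)

/-- The tangent space of `M` at `x = (p, v)`: pairs `(u, w)` with `u` orthogonal to the normal of
the face of `p`, and `w` orthogonal to `v`. -/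
def tangent (x : X d) : Submodule ℝ (X d) where
  carrier := {y | ⟪y.fst, P.normalAt x.fst⟫ = 0 ∧ ⟪y.snd, x.snd⟫ = 0}
  add_mem' := by
    rintro a b ⟨ha, ha'⟩ ⟨hb, hb'⟩
    simp [inner_add_left, ha, ha', hb, hb']
  zero_mem' := by simp
  smul_mem' := by
    rintro c a ⟨ha, ha'⟩
    simp [inner_smul_left, ha, ha']

/-- The derivative of `Φ^n` at `x`, taken along `M`. It is a linear map on the ambient space of which
only the restriction to the tangent space of `M` at `x` is used; that restriction is
determined by `Φ^n` on `M`. -/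
def DPhi (n : ℕ) (x : X d) : X d →L[ℝ] X d :=
  fderivWithin ℝ ((P.billiardMap f)^[n]) P.M x

/-- `Φ` is uniformly partially hyperbolic on the invariant set `Λ`, with the constant `C`, the
contraction rate `lam` and the expansion rate `ρ`. Continuity of a family of subspaces is continuity
of the orthogonal projections. A contracting law need not be a local diffeomorphism, so the
invariance of the stable subbundle reads `E^s(x) = DΦ(x)⁻¹ (E^s(Φ x))`; where `DΦ(x)` is
invertible this is `DΦ(x) (E^s(x)) = E^s(Φ x)`, which is included. The last clause is
`‖DΦ^{-n}|_{E^{cu}}‖ ≤ C ρ^{-n}`. -/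
def IsPartiallyHyperbolicOn (Λ : Set (X d)) (C lam ρ : ℝ) : Prop :=
  (∀ x ∈ Λ, ∀ n : ℕ, DifferentiableWithinAt ℝ ((P.billiardMap f)^[n]) P.M x) ∧
  ∃ Es Ecu : X d → Submodule ℝ (X d),
    (∀ x ∈ Λ, Disjoint (Es x) (Ecu x) ∧ Es x ⊔ Ecu x = P.tangent x) ∧
    ContinuousOn (fun x => (Es x).starProjection) Λ ∧
    ContinuousOn (fun x => (Ecu x).starProjection) Λ ∧
    (∀ x ∈ Λ,
      {y : X d | y ∈ P.tangent x ∧ P.DPhi f 1 x y ∈ Es (P.billiardMap f x)} = Es x ∧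
      (Set.InjOn (P.DPhi f 1 x) (P.tangent x) →
        P.DPhi f 1 x '' (Es x) = Es (P.billiardMap f x)) ∧
      P.DPhi f 1 x '' (Ecu x) = Ecu (P.billiardMap f x)) ∧
    (∀ x ∈ Λ, ∀ n : ℕ, 1 ≤ n → ∀ y ∈ Es x, ‖P.DPhi f n x y‖ ≤ C * lam ^ n * ‖y‖) ∧
    (∀ x ∈ Λ, ∀ n : ℕ, 1 ≤ n → ∀ y ∈ Ecu x, ‖y‖ ≤ C * (ρ ^ n)⁻¹ * ‖P.DPhi f n x y‖)

/-- `Φ` is uniformly hyperbolic on `Λ`, with the constant `C`, the contraction rate `lam < 1` and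
the expansion rate `ρ > 1`. -/
def IsUniformlyHyperbolicOn (Λ : Set (X d)) (C lam ρ : ℝ) : Prop :=
  0 < C ∧ 0 < lam ∧ lam < 1 ∧ 1 < ρ ∧ P.IsPartiallyHyperbolicOn f Λ C lam ρ

end Polytope

end PolytopeBilliard

end

/-!
In the coordinates `(u, w)` of a tangent vector at `x = (p, v)` the derivative of the billiard map is
triangular, `(u, w) ↦ (A (u + t w), K w)`: here `t` is the flight time, `A` is the projection along
`v` onto the next face, and `K` is the derivative of the reflection followed by the contraction.

The velocity part `K` contracts by a factor `contractionRate f < 1`, since the singular values of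
`D C_η` are `f' θ` and `sin (f θ) / sin θ` (`norm_contractDeriv_le`).

The position part `A` does not decrease `transverse u v`, the squared length of the component of `u`
orthogonal to the velocity. The flight and the reflection preserve it, while the contraction turns
the velocity away from the face and adds a multiple of `⟪A u, v⟫ ^ 2` to it. If it
hardly grew during a time window in which the visited normals span the space, then `u` would be
almost orthogonal to every velocity, hence almost constant. It would be orthogonal to each visited
normal when that is visited, so almost orthogonal to all of them, which is impossible for a
vector of unit length. To make the growth independent of the length of the window, only the at most
`d` collisions that enlarge the span `W` of the visited normals are counted: between two of them
the component of the velocity orthogonal to `W` decays geometrically, so that the component of `u`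
orthogonal to `W` drifts by a bounded multiple of the tolerance, while its norm is almost
preserved (`exists_growth`).

The unstable subspace is therefore `w = 0`, on which the derivative acts by `A`. The stable subspace
is a graph `u = S w` over the velocities. Its invariance reads `A (S w + t w) = S' (K w)` with `S'`
the map at the next point, and solving for `S` gives a series (`stableGraph`) that
converges uniformly, because inverses of products of the maps `A` are bounded and `K` contracts.
The stable subspace thus depends continuously on the point, and its vectors are contracted like
their velocity components.

The phase space `M` is not open in the ambient space. Around a point of the domain `M'` the faces
of departure and of arrival are constant along `M` (`Polytope.Hits.eventually`), so there the map is
the restriction of an explicit differentiable map, and every tangent vector of `M` lies in its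
tangent cone (`Polytope.tangent_subset_tangentConeAt`), so that the derivative is determined.
-/

noncomputable section

namespace PolytopeBilliard

variable {d : ℕ} {f : ℝ → ℝ}

/-! ### Contracting reflection laws -/

/-- The supremum of `|f'|`. -/
def lawRate (f : ℝ → ℝ) : ℝ := sSup ((fun θ => |derivWithin f angleDomain θ|) '' angleDomain)

/-- A common bound, less than `1`, for the two singular values `f' θ` and `sin (f θ) / sin θ` of
the derivative of the contraction `C_η`. -/
def contractionRate (f : ℝ → ℝ) : ℝ :=
  max (lawRate f) (1 - 2 / Real.pi * (1 - lawRate f) * Real.cos ((1 + lawRate f) * Real.pi / 4))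

lemma uniqueDiffOn_angleDomain : UniqueDiffOn ℝ angleDomain := uniqueDiffOn_Ico _ _

lemma zero_mem_angleDomain : (0 : ℝ) ∈ angleDomain := ⟨le_rfl, by positivity⟩

namespace IsContractingReflectionLaw

variable (hf : IsContractingReflectionLaw f)
include hf

lemma lawRate_pos : 0 < lawRate f := hf.sup_pos

lemma lawRate_lt_one : lawRate f < 1 := hf.sup_lt_one

lemma abs_derivWithin_le {θ : ℝ} (hθ : θ ∈ angleDomain) :
    |derivWithin f angleDomain θ| ≤ lawRate f :=
  le_csSup hf.bddAbove (Set.mem_image_of_mem _ hθ)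

lemma differentiableOn : DifferentiableOn ℝ f angleDomain :=
  hf.contDiffOn.differentiableOn (by norm_num)

lemma continuousOn_derivWithin : ContinuousOn (derivWithin f angleDomain) angleDomain :=
  hf.contDiffOn.continuousOn_derivWithin uniqueDiffOn_angleDomain (by norm_num)

lemma nonneg {θ : ℝ} (hθ : θ ∈ angleDomain) : 0 ≤ f θ := (hf.mapsTo hθ).1

lemma le_mul {θ : ℝ} (hθ : θ ∈ angleDomain) : f θ ≤ lawRate f * θ := by
  have h := (convex_Ico 0 (Real.pi / 2)).norm_image_sub_le_of_norm_derivWithin_le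
    (f := f) (C := lawRate f) hf.differentiableOn (fun x hx => hf.abs_derivWithin_le hx)
    zero_mem_angleDomain hθ
  rw [hf.map_zero, sub_zero, sub_zero, Real.norm_eq_abs, Real.norm_eq_abs,
    abs_of_nonneg hθ.1] at h
  exact (le_abs_self _).trans h

lemma cos_pos {θ : ℝ} (hθ : θ ∈ angleDomain) : 0 < Real.cos (f θ) :=
  Real.cos_pos_of_mem_Ioo ⟨by linarith [hf.nonneg hθ, Real.pi_pos], (hf.mapsTo hθ).2⟩

lemma cos_lawRate_pos : 0 < Real.cos (lawRate f * (Real.pi / 2)) := by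
  have := hf.lawRate_pos
  have := hf.lawRate_lt_one
  apply Real.cos_pos_of_mem_Ioo
  constructor <;> nlinarith [Real.pi_pos]

lemma cos_lawRate_le {θ : ℝ} (hθ : θ ∈ angleDomain) :
    Real.cos (lawRate f * (Real.pi / 2)) ≤ Real.cos (f θ) := by
  have := hf.lawRate_pos
  have := hf.lawRate_lt_one
  apply Real.cos_le_cos_of_nonneg_of_le_pi (hf.nonneg hθ)
  · nlinarith [Real.pi_pos]
  · exact (hf.le_mul hθ).trans (by gcongr; exact hθ.2.le)

lemma contractionRate_pos : 0 < contractionRate f := hf.lawRate_pos.trans_le (le_max_left _ _)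

lemma contractionRate_lt_one : contractionRate f < 1 := by
  have h0 := hf.lawRate_pos
  have h1 := hf.lawRate_lt_one
  refine max_lt h1 ?_
  have : 0 < Real.cos ((1 + lawRate f) * Real.pi / 4) := by
    apply Real.cos_pos_of_mem_Ioo
    constructor <;> nlinarith [Real.pi_pos]
  have : 0 < 2 / Real.pi * (1 - lawRate f) * Real.cos ((1 + lawRate f) * Real.pi / 4) := by
    have := Real.pi_pos
    have : 0 < 1 - lawRate f := by linarith
    positivity
  linarith

lemma sin_nonneg {θ : ℝ} (hθ : θ ∈ angleDomain) : 0 ≤ Real.sin (f θ) :=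
  Real.sin_nonneg_of_nonneg_of_le_pi (hf.nonneg hθ) (by
    linarith [(hf.mapsTo hθ).2, Real.pi_pos])

/-- By Jordan's inequality `sin θ - sin (l θ) = 2 sin ((1 - l) θ / 2) cos ((1 + l) θ / 2)` is at least
a fixed multiple of `θ ≥ sin θ`. -/
lemma sin_le {θ : ℝ} (hθ : θ ∈ angleDomain) :
    Real.sin (f θ) ≤ contractionRate f * Real.sin θ := by
  have h0 := hf.lawRate_pos
  have h1 := hf.lawRate_lt_one
  have hpi := Real.pi_pos
  obtain ⟨hθ0, hθ1⟩ := hθ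
  set l := lawRate f with hl
  have hs : 0 ≤ Real.sin θ := Real.sin_nonneg_of_nonneg_of_le_pi hθ0 (by linarith)
  have hsθ : Real.sin θ ≤ θ := Real.sin_le hθ0
  have hmono : Real.sin (f θ) ≤ Real.sin (l * θ) := by
    apply Real.sin_le_sin_of_le_of_le_pi_div_two
    · linarith [hf.nonneg ⟨hθ0, hθ1⟩]
    · nlinarith
    · exact hf.le_mul ⟨hθ0, hθ1⟩
  have hdiff : Real.sin θ - Real.sin (l * θ) =
      2 * Real.sin ((θ - l * θ) / 2) * Real.cos ((θ + l * θ) / 2) := Real.sin_sub_sin _ _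
  have hj : 2 / Real.pi * ((θ - l * θ) / 2) ≤ Real.sin ((θ - l * θ) / 2) := by
    apply Real.mul_le_sin <;> nlinarith
  have hc : Real.cos ((1 + l) * Real.pi / 4) ≤ Real.cos ((θ + l * θ) / 2) := by
    apply Real.cos_le_cos_of_nonneg_of_le_pi <;> nlinarith
  have hc0 : 0 < Real.cos ((1 + l) * Real.pi / 4) := by
    apply Real.cos_pos_of_mem_Ioo
    constructor <;> nlinarith [Real.pi_pos]
  have hj0 : 0 ≤ 2 / Real.pi * ((θ - l * θ) / 2) := by
    have : 0 ≤ θ - l * θ := by nlinarith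
    positivity
  have h2 : 2 / Real.pi * ((θ - l * θ) / 2) * Real.cos ((1 + l) * Real.pi / 4) ≤
      Real.sin ((θ - l * θ) / 2) * Real.cos ((θ + l * θ) / 2) :=
    mul_le_mul hj hc hc0.le (hj0.trans hj)
  have h3 : 2 / Real.pi * (1 - l) * Real.cos ((1 + l) * Real.pi / 4) * Real.sin θ ≤
      2 / Real.pi * (1 - l) * Real.cos ((1 + l) * Real.pi / 4) * θ := by
    have : 0 ≤ 1 - l := by linarith
    gcongr
  have h4 : (1 - 2 / Real.pi * (1 - l) * Real.cos ((1 + l) * Real.pi / 4)) * Real.sin θ ≤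
      contractionRate f * Real.sin θ :=
    mul_le_mul_of_nonneg_right (le_max_right _ _) hs
  nlinarith

end IsContractingReflectionLaw

/-! ### The contraction of a hemisphere -/

/-- The profile `s ↦ sin (f (arcsin s))` of `C_η` in the chart of the hemisphere that forgets the
component along `η`. -/
def profile (f : ℝ → ℝ) (s : ℝ) : ℝ := Real.sin (f (Real.arcsin s))

/-- The derivative of `profile f` on `[0, 1)`. -/
def profileDeriv (f : ℝ → ℝ) (s : ℝ) : ℝ :=
  Real.cos (f (Real.arcsin s)) * (derivWithin f angleDomain (Real.arcsin s) / √(1 - s ^ 2))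

/-- The slope `profile f s / s`, continued by `f' 0` at `s = 0`. -/
def profileSlope (f : ℝ → ℝ) (s : ℝ) : ℝ :=
  if s = 0 then derivWithin f angleDomain 0 else profile f s / s

lemma arcsin_mem_angleDomain {s : ℝ} (hs : s ∈ Set.Ico (0 : ℝ) 1) :
    Real.arcsin s ∈ angleDomain :=
  ⟨Real.arcsin_nonneg.2 hs.1, Real.arcsin_lt_pi_div_two.2 hs.2⟩

lemma profileDeriv_zero (hf : IsContractingReflectionLaw f) :
    profileDeriv f 0 = derivWithin f angleDomain 0 := by
  simp [profileDeriv, hf.map_zero]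

lemma hasDerivWithinAt_profile (hf : IsContractingReflectionLaw f) {s : ℝ}
    (hs : s ∈ Set.Ico (0 : ℝ) 1) :
    HasDerivWithinAt (profile f) (profileDeriv f s) (Set.Ico 0 1) s := by
  have h1 : HasDerivWithinAt Real.arcsin (1 / √(1 - s ^ 2)) (Set.Ico 0 1) s :=
    (Real.hasDerivAt_arcsin (by linarith [hs.1]) hs.2.ne).hasDerivWithinAt
  have h2 := (hf.differentiableOn _ (arcsin_mem_angleDomain hs)).hasDerivWithinAt
  have h3 := h2.comp s h1 (fun t ht => arcsin_mem_angleDomain ht)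
  have h4 := h3.sin
  change HasDerivWithinAt (fun s => Real.sin (f (Real.arcsin s))) _ _ _
  simpa [profileDeriv, Function.comp_def, div_eq_mul_inv] using h4

lemma continuousOn_profileDeriv (hf : IsContractingReflectionLaw f) :
    ContinuousOn (profileDeriv f) (Set.Ico 0 1) := by
  have hm : Set.MapsTo Real.arcsin (Set.Ico 0 1) angleDomain := fun s hs =>
    arcsin_mem_angleDomain hs
  have ha : ContinuousOn Real.arcsin (Set.Ico 0 1) := Real.continuous_arcsin.continuousOn
  refine ContinuousOn.mul ?_ (ContinuousOn.div ?_ ?_ ?_)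
  · exact Real.continuous_cos.comp_continuousOn (hf.differentiableOn.continuousOn.comp ha hm)
  · exact hf.continuousOn_derivWithin.comp ha hm
  · fun_prop
  · intro s hs
    have : 0 < 1 - s ^ 2 := by nlinarith [hs.1, hs.2]
    positivity

lemma continuousOn_profileSlope (hf : IsContractingReflectionLaw f) :
    ContinuousOn (profileSlope f) (Set.Ico 0 1) := by
  intro s hs
  rcases eq_or_ne s 0 with rfl | h0
  · have h := hasDerivWithinAt_profile hf hs
    rw [hasDerivWithinAt_iff_tendsto_slope] at h
    rw [← continuousWithinAt_sdiff_self]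
    have h5 : profileSlope f 0 = profileDeriv f 0 := by
      rw [profileDeriv_zero hf]; simp [profileSlope]
    rw [ContinuousWithinAt, h5]
    refine h.congr' ?_
    filter_upwards [self_mem_nhdsWithin] with t ht
    have : t ≠ 0 := ht.2
    simp [profileSlope, this, slope, profile, hf.map_zero, div_eq_inv_mul]
  · have h1 : ContinuousWithinAt (fun s => profile f s / s) (Set.Ico 0 1) s :=
      (hasDerivWithinAt_profile hf hs).continuousWithinAt.div continuousWithinAt_id h0
    refine h1.congr_of_eventuallyEq ?_ (by simp [profileSlope, h0])
    filter_upwards [nhdsWithin_le_nhds (isOpen_ne.mem_nhds h0)] with t ht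
    have : t ≠ 0 := ht
    simp [profileSlope, this]

/-- The map `C_η` in the chart of the hemisphere that forgets the component along `η`: the radial
map with the given profile. -/
def radial (f : ℝ → ℝ) (b : E d) : E d := profileSlope f ‖b‖ • b

/-- The derivative of `radial f`; its value at `0` is `f' 0` times the identity. -/
def radialDeriv (f : ℝ → ℝ) (b : E d) : E d →L[ℝ] E d :=
  profileSlope f ‖b‖ • ContinuousLinearMap.id ℝ (E d) +
    ((profileDeriv f ‖b‖ - profileSlope f ‖b‖) / ‖b‖ ^ 2) • (innerSL ℝ b).smulRight b

lemma radialDeriv_apply (b k : E d) :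
    radialDeriv f b k = profileSlope f ‖b‖ • k +
      ((profileDeriv f ‖b‖ - profileSlope f ‖b‖) / ‖b‖ ^ 2 * ⟪b, k⟫) • b := by
  simp [radialDeriv, mul_smul]

lemma norm_mem_Ico {b : E d} (hb : b ∈ Metric.ball (0 : E d) 1) : ‖b‖ ∈ Set.Ico (0 : ℝ) 1 :=
  ⟨norm_nonneg b, by simpa using hb⟩

lemma hasFDerivAt_radial (hf : IsContractingReflectionLaw f) {b : E d}
    (hb : b ∈ Metric.ball (0 : E d) 1) : HasFDerivAt (radial f) (radialDeriv f b) b := by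
  have hbI := norm_mem_Ico hb
  rcases eq_or_ne b 0 with rfl | h0
  · -- at the centre the difference quotient converges because `profileSlope` is continuous
    have hc : Filter.Tendsto (fun b : E d => profileSlope f ‖b‖ - profileSlope f 0)
        (nhds 0) (nhds 0) := by
      have h1 := continuousOn_profileSlope hf 0 (by simp)
      have h2 : Filter.Tendsto (fun b : E d => ‖b‖) (nhds 0) (nhdsWithin 0 (Set.Ico 0 1)) := by
        rw [tendsto_nhdsWithin_iff]
        refine ⟨by simpa using (continuous_norm (E := E d)).tendsto 0, ?_⟩
        filter_upwards [Metric.ball_mem_nhds (0 : E d) one_pos] with b hb using norm_mem_Ico hb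
      simpa using (h1.tendsto.comp h2).sub_const (profileSlope f 0)
    rw [hasFDerivAt_iff_isLittleO]
    have : (fun b' : E d => radial f b' - radial f 0 - (radialDeriv f (0 : E d)) (b' - 0)) =
        fun b' => (profileSlope f ‖b'‖ - profileSlope f 0) • b' := by
      ext1 b'
      simp [radial, radialDeriv, sub_smul]
    rw [this]
    simpa using (((Asymptotics.isLittleO_one_iff ℝ).2 hc).smul_isBigO
      (Asymptotics.isBigO_refl (fun b' : E d => b') (nhds 0)))
  · have hs : 0 < ‖b‖ := norm_pos_iff.2 h0
    have hφ : HasDerivAt (profile f) (profileDeriv f ‖b‖) ‖b‖ :=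
      (hasDerivWithinAt_profile hf hbI).hasDerivAt (Ico_mem_nhds hs hbI.2)
    have hg : HasDerivAt (fun s => profile f s / s)
        ((profileDeriv f ‖b‖ * ‖b‖ - profile f ‖b‖ * 1) / ‖b‖ ^ 2) ‖b‖ :=
      hφ.div (hasDerivAt_id _) hs.ne'
    have hn : HasFDerivAt (fun b : E d => ‖b‖) (‖b‖⁻¹ • innerSL ℝ b) b := by
      have h1 := ((hasStrictFDerivAt_norm_sq b).hasFDerivAt).sqrt (by positivity)
      simp only [Real.sqrt_sq (norm_nonneg _)] at h1
      refine h1.congr_fderiv ?_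
      ext k
      simp
      field_simp
    have h2 := (hg.comp_hasFDerivAt b hn).smul (hasFDerivAt_id b)
    refine (h2.congr_of_eventuallyEq ?_).congr_fderiv ?_
    · filter_upwards [isOpen_ne.mem_nhds h0] with b' hb'
      have : ‖b'‖ ≠ 0 := norm_ne_zero_iff.2 hb'
      simp [radial, profileSlope, this]
    · ext1 k
      rw [radialDeriv_apply]
      simp [profileSlope, hs.ne', smul_smul]
      congr 2
      field_simp

lemma continuousOn_radialDeriv (hf : IsContractingReflectionLaw f) :
    ContinuousOn (radialDeriv f) (Metric.ball (0 : E d) 1) := by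
  have hm : Set.MapsTo (fun b : E d => ‖b‖) (Metric.ball (0 : E d) 1) (Set.Ico 0 1) :=
    fun b hb => norm_mem_Ico hb
  have hS : ContinuousOn (fun b : E d => profileSlope f ‖b‖) (Metric.ball (0 : E d) 1) :=
    (continuousOn_profileSlope hf).comp continuous_norm.continuousOn hm
  have hD : ContinuousOn (fun b : E d => profileDeriv f ‖b‖) (Metric.ball (0 : E d) 1) :=
    (continuousOn_profileDeriv hf).comp continuous_norm.continuousOn hm
  have hL : Continuous (fun b : E d => (innerSL ℝ b).smulRight b) :=
    ((ContinuousLinearMap.smulRightL ℝ (E d) (E d)).continuous.comp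
      (innerSL ℝ (E := E d)).continuous).clm_apply continuous_id
  refine (hS.smul continuousOn_const).add ?_
  intro b hb
  rcases eq_or_ne b 0 with rfl | h0
  · have h1 := (hD.sub hS) 0 hb
    have h2 : profileDeriv f ‖(0 : E d)‖ - profileSlope f ‖(0 : E d)‖ = 0 := by
      simp [profileDeriv_zero hf, profileSlope]
    have h3 : Filter.Tendsto (fun b : E d => profileDeriv f ‖b‖ - profileSlope f ‖b‖)
        (nhdsWithin 0 (Metric.ball (0 : E d) 1)) (nhds 0) := by
      have := h1.tendsto
      simp only [Pi.sub_apply] at this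
      rwa [h2] at this
    rw [ContinuousWithinAt]
    simp only [norm_zero, map_zero]
    have h4 : ((profileDeriv f 0 - profileSlope f 0) / (0 : ℝ) ^ 2) •
        (0 : E d →L[ℝ] ℝ).smulRight (0 : E d) = 0 := by ext; simp
    rw [h4]
    refine squeeze_zero_norm (fun b => ?_) (by simpa using h3.norm)
    rw [norm_smul, ContinuousLinearMap.norm_smulRight_apply, innerSL_apply_norm, norm_div,
      norm_pow, norm_norm, ← sq, ← Real.norm_eq_abs]
    rcases eq_or_ne b 0 with rfl | hb0
    · simp
    · have : ‖b‖ ≠ 0 := norm_ne_zero_iff.2 hb0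
      rw [div_mul_cancel₀ _ (by positivity)]
  · have : ‖b‖ ^ 2 ≠ 0 := by have := norm_ne_zero_iff.2 h0; positivity
    exact ((hD.sub hS b hb).div (by fun_prop) this).smul hL.continuousWithinAt

/-! ### The contraction as a map of the sphere -/

/-- The orthogonal projection along the unit vector `η`. -/
def perp (η : E d) : E d →L[ℝ] E d :=
  ContinuousLinearMap.id ℝ (E d) - (innerSL ℝ η).smulRight η

lemma perp_apply (η z : E d) : perp η z = z - ⟪η, z⟫ • η := by simp [perp]

lemma inner_perp_self {η : E d} (hη : ‖η‖ = 1) (z : E d) : ⟪η, perp η z⟫ = 0 := by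
  simp [perp_apply, inner_sub_right, inner_smul_right, hη]

lemma inner_perp_of_inner_eq_zero {η z w : E d} (hz : ⟪η, z⟫ = 0) : ⟪z, perp η w⟫ = ⟪z, w⟫ := by
  simp [perp_apply, inner_sub_right, inner_smul_right, real_inner_comm, hz]

lemma perp_of_inner_eq_zero {η z : E d} (hz : ⟪η, z⟫ = 0) : perp η z = z := by
  simp [perp_apply, hz]

lemma norm_perp_sq {η : E d} (hη : ‖η‖ = 1) (z : E d) :
    ‖perp η z‖ ^ 2 = ‖z‖ ^ 2 - ⟪η, z⟫ ^ 2 := by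
  rw [perp_apply, norm_sub_sq_real, inner_smul_right, norm_smul, hη, mul_one,
    Real.norm_eq_abs, sq_abs, real_inner_comm]
  ring

lemma norm_perp_le {η : E d} (hη : ‖η‖ = 1) (z : E d) : ‖perp η z‖ ≤ ‖z‖ := by
  have := norm_perp_sq hη z
  exact le_of_sq_le_sq (by nlinarith [sq_nonneg ⟪η, z⟫]) (norm_nonneg z)

lemma norm_add_smul_sq {η z : E d} (hη : ‖η‖ = 1) (hz : ⟪η, z⟫ = 0) (r : ℝ) :
    ‖z + r • η‖ ^ 2 = ‖z‖ ^ 2 + r ^ 2 := by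
  rw [norm_add_sq_real, inner_smul_right, norm_smul, hη, real_inner_comm, hz, mul_one,
    Real.norm_eq_abs, sq_abs]
  ring

/-- The point of the unit hemisphere of `η` with the given component orthogonal to `η`. -/
def lift (η β : E d) : E d := β + √(1 - ‖β‖ ^ 2) • η

/-- The derivative of `lift η`. -/
def liftDeriv (η β : E d) : E d →L[ℝ] E d :=
  ContinuousLinearMap.id ℝ (E d) - (1 / √(1 - ‖β‖ ^ 2)) • (innerSL ℝ β).smulRight η

lemma hasFDerivAt_lift (η : E d) {β : E d} (hβ : β ∈ Metric.ball (0 : E d) 1) :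
    HasFDerivAt (lift η) (liftDeriv η β) β := by
  have hb := norm_mem_Ico hβ
  have h0 : 1 - ‖β‖ ^ 2 ≠ 0 := by nlinarith [hb.1, hb.2]
  have h1 := ((hasStrictFDerivAt_norm_sq β).hasFDerivAt.const_sub 1).sqrt h0
  refine ((hasFDerivAt_id β).add (h1.smul_const η)).congr_fderiv ?_
  ext1 k
  have h2 : (1 / (2 * √(1 - ‖β‖ ^ 2)) * -(2 * ⟪β, k⟫)) = -(1 / √(1 - ‖β‖ ^ 2) * ⟪β, k⟫) := by
    field_simp
  simp only [liftDeriv, add_apply, sub_apply,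
    ContinuousLinearMap.id_apply, ContinuousLinearMap.smulRight_apply,
    smul_apply, neg_apply, innerSL_apply_apply,
    nsmul_eq_mul, Nat.cast_ofNat, smul_eq_mul, smul_smul]
  rw [h2, neg_smul, ← sub_eq_add_neg]

lemma continuousOn_liftDeriv (η : E d) :
    ContinuousOn (liftDeriv η) (Metric.ball (0 : E d) 1) := by
  have hL : Continuous (fun β : E d => (innerSL ℝ β).smulRight η) :=
    ((ContinuousLinearMap.smulRightL ℝ (E d) (E d)).continuous.comp
      (innerSL ℝ (E := E d)).continuous).clm_apply continuous_const
  have hq : ContinuousOn (fun β : E d => 1 / √(1 - ‖β‖ ^ 2)) (Metric.ball (0 : E d) 1) := by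
    refine ContinuousOn.div (by fun_prop) (by fun_prop) ?_
    intro β hβ
    have hb := norm_mem_Ico hβ
    have h0 : 0 < 1 - ‖β‖ ^ 2 := by nlinarith [hb.1, hb.2]
    positivity
  exact continuousOn_const.sub (hq.smul hL.continuousOn)

lemma profile_sq_lt_one (hf : IsContractingReflectionLaw f) {s : ℝ}
    (hs : s ∈ Set.Ico (0 : ℝ) 1) : profile f s ^ 2 < 1 := by
  have := hf.cos_pos (arcsin_mem_angleDomain hs)
  have := Real.sin_sq_add_cos_sq (f (Real.arcsin s))
  unfold profile
  nlinarith

lemma norm_radial (hf : IsContractingReflectionLaw f) {b : E d}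
    (hb : b ∈ Metric.ball (0 : E d) 1) : ‖radial f b‖ = profile f ‖b‖ := by
  rcases eq_or_ne b 0 with rfl | h0
  · simp [radial, profile, hf.map_zero]
  · have h1 : ‖b‖ ≠ 0 := norm_ne_zero_iff.2 h0
    have h2 : 0 ≤ profile f ‖b‖ := hf.sin_nonneg (arcsin_mem_angleDomain (norm_mem_Ico hb))
    rw [radial, norm_smul, profileSlope, if_neg h1, Real.norm_eq_abs, abs_div, abs_of_nonneg h2,
      abs_norm, div_mul_cancel₀ _ h1]

lemma radial_mem_ball (hf : IsContractingReflectionLaw f) {b : E d}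
    (hb : b ∈ Metric.ball (0 : E d) 1) : radial f b ∈ Metric.ball (0 : E d) 1 := by
  have := profile_sq_lt_one hf (norm_mem_Ico hb)
  rw [← norm_radial hf hb] at this
  rw [mem_ball_zero_iff]
  nlinarith [norm_nonneg (radial f b)]

lemma abs_profileSlope_le (hf : IsContractingReflectionLaw f) {s : ℝ}
    (hs : s ∈ Set.Ico (0 : ℝ) 1) : |profileSlope f s| ≤ contractionRate f := by
  unfold profileSlope
  split_ifs with h
  · exact (hf.abs_derivWithin_le zero_mem_angleDomain).trans (le_max_left _ _)
  · have hs0 : 0 < s := lt_of_le_of_ne hs.1 (Ne.symm h)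
    have h1 := hf.sin_le (arcsin_mem_angleDomain hs)
    rw [Real.sin_arcsin (by linarith [hs.1]) hs.2.le] at h1
    rw [abs_div, abs_of_pos hs0, div_le_iff₀ hs0, abs_of_nonneg]
    · exact h1
    · exact hf.sin_nonneg (arcsin_mem_angleDomain hs)

/-- The extension of the contraction `C_η` to a neighbourhood of the hemisphere that is constant
along `η`. -/
def contractExt (f : ℝ → ℝ) (η a : E d) : E d := lift η (radial f (perp η a))

/-- The derivative of `contractExt f η`. -/
def contractDeriv (f : ℝ → ℝ) (η a : E d) : E d →L[ℝ] E d :=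
  liftDeriv η (radial f (perp η a)) ∘L radialDeriv f (perp η a) ∘L perp η

lemma hasFDerivAt_contractExt (hf : IsContractingReflectionLaw f) (η : E d) {a : E d}
    (ha : perp η a ∈ Metric.ball (0 : E d) 1) :
    HasFDerivAt (contractExt f η) (contractDeriv f η a) a :=
  (hasFDerivAt_lift η (radial_mem_ball hf ha)).comp a
    ((hasFDerivAt_radial hf ha).comp a (perp η).hasFDerivAt)

lemma continuousOn_contractDeriv (hf : IsContractingReflectionLaw f) (η : E d) :
    ContinuousOn (contractDeriv f η) (perp η ⁻¹' Metric.ball (0 : E d) 1) := by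
  have hm : Set.MapsTo (perp η) (perp η ⁻¹' Metric.ball (0 : E d) 1) (Metric.ball 0 1) :=
    fun a ha => ha
  have hr : ContinuousOn (radial f) (Metric.ball (0 : E d) 1) := fun b hb =>
    (hasFDerivAt_radial hf hb).continuousAt.continuousWithinAt
  refine ContinuousOn.clm_comp ?_ (ContinuousOn.clm_comp ?_ continuousOn_const)
  · exact (continuousOn_liftDeriv η).comp (hr.comp (perp η).continuous.continuousOn hm)
      (fun a ha => radial_mem_ball hf ha)
  · exact (continuousOn_radialDeriv hf).comp (perp η).continuous.continuousOn hm

lemma perp_mem_ball {η a : E d} (hη : ‖η‖ = 1) (ha : a ∈ hemisphere η) :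
    perp η a ∈ Metric.ball (0 : E d) 1 := by
  rw [mem_ball_zero_iff]
  have h1 := norm_perp_sq hη a
  rw [ha.1, real_inner_comm] at h1
  nlinarith [ha.2, norm_nonneg (perp η a), mul_pos ha.2 ha.2]

lemma norm_perp_hemisphere {η a : E d} (hη : ‖η‖ = 1) (ha : a ∈ hemisphere η) :
    ‖perp η a‖ = √(1 - ⟪a, η⟫ ^ 2) := by
  rw [← Real.sqrt_sq (norm_nonneg (perp η a)), norm_perp_sq hη, ha.1, real_inner_comm, one_pow]

lemma arccos_inner {η a : E d} (hη : ‖η‖ = 1) (ha : a ∈ hemisphere η) :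
    Real.arccos ⟪a, η⟫ = Real.arcsin ‖perp η a‖ := by
  rw [Real.arccos_eq_arcsin ha.2.le, norm_perp_hemisphere hη ha]

lemma inner_le_one_of_hemisphere {η a : E d} (hη : ‖η‖ = 1) (ha : a ∈ hemisphere η) :
    ⟪a, η⟫ ≤ 1 := by
  have := real_inner_le_norm a η
  rwa [ha.1, hη, mul_one] at this

lemma arccos_mem_angleDomain {η a : E d} (hη : ‖η‖ = 1) (ha : a ∈ hemisphere η) :
    Real.arccos ⟪a, η⟫ ∈ angleDomain := by
  rw [arccos_inner hη ha]
  exact arcsin_mem_angleDomain (norm_mem_Ico (perp_mem_ball hη ha))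

lemma contract_eq (f : ℝ → ℝ) {η a : E d} (hη : ‖η‖ = 1)
    (ha : a ∈ hemisphere η) :
    contract f η a = radial f (perp η a) + Real.cos (f (Real.arccos ⟪a, η⟫)) • η := by
  have h1 := inner_le_one_of_hemisphere hη ha
  have h2 : (a - ⟪a, η⟫ • η) = perp η a := by rw [perp_apply, real_inner_comm]
  rw [contract, Real.cos_arccos (by linarith [ha.2]) h1, smul_smul, div_mul_cancel₀ _ ha.2.ne',
    add_comm, h2, radial, Real.sin_arccos, ← norm_perp_hemisphere hη ha]
  congr 1
  rcases eq_or_ne (perp η a) 0 with h0 | h0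
  · simp [h0]
  · rw [profileSlope, if_neg (norm_ne_zero_iff.2 h0), profile, arccos_inner hη ha]

lemma contract_eq_contractExt (hf : IsContractingReflectionLaw f) {η a : E d} (hη : ‖η‖ = 1)
    (ha : a ∈ hemisphere η) : contract f η a = contractExt f η a := by
  have hb := perp_mem_ball hη ha
  rw [contract_eq f hη ha, contractExt, lift, norm_radial hf hb, profile, ← arccos_inner hη ha]
  have h := hf.cos_pos (arccos_mem_angleDomain hη ha)
  rw [← Real.cos_sq', Real.sqrt_sq h.le]

lemma inner_radial (f : ℝ → ℝ) {η b : E d} (hb : ⟪η, b⟫ = 0) : ⟪η, radial f b⟫ = 0 := by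
  simp [radial, inner_smul_right, hb]

lemma perp_contract (f : ℝ → ℝ) {η a : E d} (hη : ‖η‖ = 1)
    (ha : a ∈ hemisphere η) :
    perp η (contract f η a) = profileSlope f ‖perp η a‖ • perp η a := by
  rw [contract_eq f hη ha, map_add, map_smul,
    perp_of_inner_eq_zero (inner_radial f (inner_perp_self hη a)), perp_apply η η]
  simp [hη, radial]

lemma inner_contract (f : ℝ → ℝ) {η a : E d} (hη : ‖η‖ = 1)
    (ha : a ∈ hemisphere η) :
    ⟪contract f η a, η⟫ = Real.cos (f (Real.arccos ⟪a, η⟫)) := by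
  rw [contract_eq f hη ha, inner_add_left, inner_smul_left, real_inner_comm,
    inner_radial f (inner_perp_self hη a)]
  simp [hη]

lemma norm_contract (hf : IsContractingReflectionLaw f) {η a : E d} (hη : ‖η‖ = 1)
    (ha : a ∈ hemisphere η) : ‖contract f η a‖ = 1 := by
  have hb := perp_mem_ball hη ha
  rw [← sq_eq_sq₀ (norm_nonneg _) zero_le_one, contract_eq f hη ha,
    norm_add_smul_sq hη (inner_radial f (inner_perp_self hη a)), norm_radial hf hb, profile,
    ← arccos_inner hη ha, one_pow, Real.sin_sq_add_cos_sq]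

lemma contract_mem_hemisphere (hf : IsContractingReflectionLaw f) {η a : E d} (hη : ‖η‖ = 1)
    (ha : a ∈ hemisphere η) : contract f η a ∈ hemisphere η :=
  ⟨norm_contract hf hη ha, by
    rw [inner_contract f hη ha]; exact hf.cos_pos (arccos_mem_angleDomain hη ha)⟩

/-- The contraction `C_η` contracts the round metric of the hemisphere: the singular values of its
derivative are `f' θ` in the radial direction and `sin (f θ) / sin θ` in the orthogonal ones. -/
lemma norm_contractDeriv_le (hf : IsContractingReflectionLaw f) {η a h : E d} (hη : ‖η‖ = 1)
    (ha : a ∈ hemisphere η) (hh : ⟪a, h⟫ = 0) :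
    ‖contractDeriv f η a h‖ ≤ contractionRate f * ‖h‖ := by
  have hb := perp_mem_ball hη ha
  have hs := norm_mem_Ico hb
  have hθ := arccos_mem_angleDomain hη ha
  have hl := hf.contractionRate_pos
  set c := ⟪a, η⟫ with hc
  have hc0 : 0 < c := ha.2
  set b := perp η a with hbdef
  set k₀ := perp η h with hk₀
  have hηb : ⟪η, b⟫ = 0 := inner_perp_self hη a
  have hηk₀ : ⟪η, k₀⟫ = 0 := inner_perp_self hη h
  have hk₀n : ‖k₀‖ ^ 2 = ‖h‖ ^ 2 - ⟪η, h⟫ ^ 2 := norm_perp_sq hη h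
  set s := ‖b‖ with hsdef
  have hs2 : s ^ 2 = 1 - c ^ 2 := by rw [hsdef, norm_perp_sq hη, ha.1, real_inner_comm]; simp [hc]
  set g := profileSlope f s with hg
  have hgl : g ^ 2 ≤ contractionRate f ^ 2 := by
    rw [← sq_abs g]; exact pow_le_pow_left₀ (abs_nonneg _) (abs_profileSlope_le hf hs) 2
  refine le_of_sq_le_sq ?_ (by positivity)
  rw [mul_pow]
  have hrad : radial f b = g • b := rfl
  set φ' := profileDeriv f s with hφ'
  set Y := ⟪b, k₀⟫ with hY
  have hk : radialDeriv f b k₀ = g • k₀ + ((φ' - g) / s ^ 2 * Y) • b := radialDeriv_apply b k₀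
  have happ : contractDeriv f η a h = radialDeriv f b k₀ +
      (-(1 / √(1 - ‖radial f b‖ ^ 2) * ⟪radial f b, radialDeriv f b k₀⟫)) • η := by
    simp [contractDeriv, liftDeriv, smul_smul, sub_eq_add_neg, ← hbdef, ← hk₀]
  have hort : ⟪η, radialDeriv f b k₀⟫ = 0 := by
    rw [hk, inner_add_right, inner_smul_right, inner_smul_right, hηb, hηk₀]; simp
  rw [happ, norm_add_smul_sq hη hort]
  -- the components of `h` and `a` along `η` and orthogonal to it
  have hrel : c * ⟪η, h⟫ + Y = 0 := by
    have h1 : Y = ⟪b, h⟫ := inner_perp_of_inner_eq_zero hηb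
    have h2 : b = a - c • η := by rw [hbdef, perp_apply, real_inner_comm]
    rw [h1, h2, inner_sub_left, inner_smul_left, hh]
    simp
  rcases eq_or_ne b 0 with h0 | h0
  · have : radialDeriv f b k₀ = g • k₀ := by rw [hk, h0]; simp
    rw [hrad, this, h0, norm_smul, mul_pow, Real.norm_eq_abs, sq_abs]
    simp only [smul_zero, inner_zero_left, mul_zero, neg_zero]
    nlinarith [sq_nonneg ⟪η, h⟫, sq_nonneg ‖k₀‖]
  · have hs0 : 0 < s := norm_pos_iff.2 h0
    set F := Real.cos (f (Real.arcsin s)) with hF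
    set D := derivWithin f angleDomain (Real.arcsin s) with hD
    have hθ' := arcsin_mem_angleDomain hs
    have hF0 : 0 < F := hf.cos_pos hθ'
    have hDl : D ^ 2 ≤ contractionRate f ^ 2 := by
      rw [← sq_abs D]
      exact pow_le_pow_left₀ (abs_nonneg _)
        ((hf.abs_derivWithin_le hθ').trans (le_max_left _ _)) 2
    have hφ : φ' = F * (D / c) := by
      rw [hφ', profileDeriv, hs2]
      congr 3
      rw [sub_sub_cancel, Real.sqrt_sq hc0.le]
    have hradn : 1 - ‖radial f b‖ ^ 2 = F ^ 2 := by
      rw [norm_radial hf hb, profile, ← Real.cos_sq']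
    have hg2 : g ^ 2 * s ^ 2 = 1 - F ^ 2 := by
      rw [← hradn, hrad, norm_smul, mul_pow, Real.norm_eq_abs, sq_abs]; ring
    have hkn : ‖radialDeriv f b k₀‖ ^ 2 = g ^ 2 * ‖k₀‖ ^ 2 + Y ^ 2 / s ^ 2 * (φ' ^ 2 - g ^ 2) := by
      rw [hk, norm_add_sq_real, norm_smul, norm_smul, inner_smul_left, inner_smul_right,
        real_inner_comm, ← hY, mul_pow, mul_pow, Real.norm_eq_abs, Real.norm_eq_abs, sq_abs,
        sq_abs, ← hsdef]
      simp only [conj_trivial]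
      field_simp
      ring
    have hin : ⟪radial f b, radialDeriv f b k₀⟫ = g * φ' * Y := by
      rw [hrad, hk, inner_smul_left, inner_add_right, inner_smul_right, inner_smul_right,
        real_inner_self_eq_norm_sq, ← hY, ← hsdef]
      simp only [conj_trivial]
      field_simp
      ring
    have hCS : Y ^ 2 / s ^ 2 ≤ ‖k₀‖ ^ 2 := by
      rw [div_le_iff₀ (by positivity)]
      have := abs_real_inner_le_norm b k₀
      rw [← sq_abs Y]
      calc |Y| ^ 2 ≤ (‖b‖ * ‖k₀‖) ^ 2 := pow_le_pow_left₀ (abs_nonneg _) this 2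
        _ = _ := by rw [mul_pow, ← hsdef]; ring
    have hm : ⟪η, h⟫ ^ 2 = Y ^ 2 / c ^ 2 := by
      field_simp
      have : c * ⟪η, h⟫ = -Y := by linarith
      rw [← mul_pow, mul_comm, this, neg_sq]
    have hhn : ‖h‖ ^ 2 = (‖k₀‖ ^ 2 - Y ^ 2 / s ^ 2) + Y ^ 2 / (s ^ 2 * c ^ 2) := by
      have h1 : ‖h‖ ^ 2 = ‖k₀‖ ^ 2 + Y ^ 2 / c ^ 2 := by rw [← hm]; linarith
      have h2 : Y ^ 2 / c ^ 2 = Y ^ 2 / (s ^ 2 * c ^ 2) - Y ^ 2 / s ^ 2 := by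
        field_simp
        rw [hs2]
      rw [h1, h2]; ring
    have htot : g ^ 2 * ‖k₀‖ ^ 2 + Y ^ 2 / s ^ 2 * (φ' ^ 2 - g ^ 2) +
        (-(1 / √(F ^ 2) * (g * φ' * Y))) ^ 2 =
        g ^ 2 * (‖k₀‖ ^ 2 - Y ^ 2 / s ^ 2) + D ^ 2 * (Y ^ 2 / (s ^ 2 * c ^ 2)) := by
      rw [Real.sqrt_sq hF0.le, hφ]
      have e1 : (-(1 / F * (g * (F * (D / c)) * Y))) ^ 2 =
          (g ^ 2 * s ^ 2) * (D ^ 2 * (Y ^ 2 / (s ^ 2 * c ^ 2))) := by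
        field_simp
      rw [e1, hg2]
      field_simp
      try ring
    rw [hradn, hkn, hin, htot, hhn, mul_add]
    have : 0 ≤ ‖k₀‖ ^ 2 - Y ^ 2 / s ^ 2 := by linarith
    gcongr

/-! ### Free flight and the derivative of the billiard map -/

/-- The oblique projection along `v` onto the hyperplane orthogonal to `n`. -/
def oblique (v n : E d) : E d →L[ℝ] E d :=
  ContinuousLinearMap.id ℝ (E d) - (⟪n, v⟫⁻¹) • (innerSL ℝ n).smulRight v

/-- The reflection about the hyperplane orthogonal to `η` as a linear map. -/
def reflectL (η : E d) : E d →L[ℝ] E d :=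
  ContinuousLinearMap.id ℝ (E d) - (2 : ℝ) • (innerSL ℝ η).smulRight η

lemma oblique_apply (v n z : E d) : oblique v n z = z - (⟪n, v⟫⁻¹ * ⟪n, z⟫) • v := by
  simp [oblique, smul_smul]

lemma reflectL_apply (η z : E d) : reflectL η z = reflect η z := by
  simp [reflectL, reflect, smul_smul, real_inner_comm]

lemma continuousAt_oblique {n v : E d} (h : ⟪n, v⟫ ≠ 0) :
    ContinuousAt (fun v => oblique v n) v := by
  have hL : Continuous (fun v : E d => (innerSL ℝ n).smulRight v) :=
    (ContinuousLinearMap.smulRightL ℝ (E d) (E d) (innerSL ℝ n)).continuous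
  have h1 : ContinuousAt (fun v : E d => ⟪n, v⟫⁻¹) v :=
    ContinuousAt.inv₀ (by fun_prop) h
  exact continuousAt_const.sub (h1.smul hL.continuousAt)

lemma inner_reflect {η : E d} (hη : ‖η‖ = 1) (z : E d) : ⟪reflect η z, η⟫ = -⟪z, η⟫ := by
  simp [reflect, inner_sub_left, inner_smul_left, hη]
  ring

lemma inner_reflect_reflect {η : E d} (hη : ‖η‖ = 1) (z w : E d) :
    ⟪reflect η z, reflect η w⟫ = ⟪z, w⟫ := by
  simp [reflect, inner_sub_left, inner_smul_left, inner_sub_right, inner_smul_right, hη,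
    real_inner_comm]
  ring

lemma norm_reflect {η : E d} (hη : ‖η‖ = 1) (z : E d) : ‖reflect η z‖ = ‖z‖ := by
  rw [← sq_eq_sq₀ (norm_nonneg _) (norm_nonneg _), ← real_inner_self_eq_norm_sq,
    ← real_inner_self_eq_norm_sq, inner_reflect_reflect hη]

lemma reflect_mem_hemisphere {η v : E d} (hη : ‖η‖ = 1) (hv : ‖v‖ = 1) (h : ⟪η, v⟫ < 0) :
    reflect η v ∈ hemisphere η := by
  refine ⟨by rw [norm_reflect hη, hv], ?_⟩
  rw [inner_reflect hη, real_inner_comm]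
  linarith

lemma perp_reflect {η : E d} (hη : ‖η‖ = 1) (v : E d) : perp η (reflect η v) = perp η v := by
  simp [reflect, perp_apply, inner_sub_right, inner_smul_right, hη, real_inner_comm]
  module

/-- The derivative of `C_η` is tangent to the unit sphere. -/
lemma inner_contract_contractDeriv (hf : IsContractingReflectionLaw f) {η a : E d} (hη : ‖η‖ = 1)
    (ha : a ∈ hemisphere η) (h : E d) : ⟪contractDeriv f η a h, contract f η a⟫ = 0 := by
  have hb := perp_mem_ball hη ha
  have hβ := norm_mem_Ico (radial_mem_ball hf hb)
  set β := radial f (perp η a) with hβdef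
  have hηβ : ⟪η, β⟫ = 0 := inner_radial f (inner_perp_self hη a)
  have hF : 0 < √(1 - ‖β‖ ^ 2) := Real.sqrt_pos.2 (by nlinarith [hβ.1, hβ.2])
  have hk : ⟪η, radialDeriv f (perp η a) (perp η h)⟫ = 0 := by
    rw [radialDeriv_apply, inner_add_right, inner_smul_right, inner_smul_right,
      inner_perp_self hη, inner_perp_self hη]
    simp
  have happ : contractDeriv f η a h = radialDeriv f (perp η a) (perp η h) -
      (1 / √(1 - ‖β‖ ^ 2) * ⟪β, radialDeriv f (perp η a) (perp η h)⟫) • η := by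
    simp [contractDeriv, liftDeriv, smul_smul, ← hβdef]
  rw [contract_eq_contractExt hf hη ha, contractExt, lift, ← hβdef, happ]
  have hβη : ⟪β, η⟫ = 0 := by rw [real_inner_comm, hηβ]
  rw [real_inner_comm, inner_add_left, inner_smul_left, inner_sub_right, inner_sub_right,
    inner_smul_right, inner_smul_right, hβη, hk, real_inner_self_eq_norm_sq, hη]
  simp only [conj_trivial]
  field_simp
  ring

namespace Polytope
variable (P : Polytope d)

variable {P} in
lemma mem_faceInterior_iff {i : Fin P.N} {p : E d} : p ∈ P.faceInterior i ↔
    ⟪P.normal i, p⟫ = P.offset i ∧ ∀ k, k ≠ i → P.offset k < ⟪P.normal k, p⟫ := by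
  constructor
  · rintro ⟨⟨h1, h2⟩, h3⟩
    exact ⟨h2, fun k hk => lt_of_le_of_ne (h1 k) fun h => h3 k hk ⟨h1, h.symm⟩⟩
  · rintro ⟨h1, h2⟩
    refine ⟨⟨fun k => ?_, h1⟩, fun k hk h => (h2 k hk).ne' h.2⟩
    rcases eq_or_ne k i with rfl | hk
    · exact h1.ge
    · exact (h2 k hk).le

variable {P} in
lemma normalAt_eq {i : Fin P.N} {p : E d} (hp : p ∈ P.faceInterior i) :
    P.normalAt p = P.normal i := by
  have h : ∃ i, p ∈ P.faceInterior i := ⟨i, hp⟩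
  rw [normalAt, dif_pos h]
  congr 1
  by_contra hne
  exact h.choose_spec.2 i (Ne.symm hne) hp.1

/-- The time at which the line `p + t v` meets the supporting hyperplane of the face `F_j`. -/
def hitTime (j : Fin P.N) (x : X d) : ℝ :=
  (P.offset j - ⟪P.normal j, x.fst⟫) / ⟪P.normal j, x.snd⟫

/-- The orbit segment of `x` starts on the face `F_i` and next hits the face `F_j`, both in their
relative interiors. -/
structure Hits (i j : Fin P.N) (x : X d) : Prop where
  start_mem : x.fst ∈ P.faceInterior i
  dir_mem : x.snd ∈ hemisphere (P.normal i)
  inner_neg : ⟪P.normal j, x.snd⟫ < 0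
  end_mem : x.fst + P.hitTime j x • x.snd ∈ P.faceInterior j

/-- A half-line that starts in the relative interior of a face, points inwards and misses the
skeleton leaves the polytope through the relative interior of a face. -/
lemma exists_hits {x : X d} (hx : x ∈ P.M') : ∃ i j, P.Hits i j x := by
  obtain ⟨⟨i, hp, hv⟩, hsk⟩ := hx
  have hp' := mem_faceInterior_iff.1 hp
  have hne : (Finset.univ.filter fun k => ⟪P.normal k, x.snd⟫ < 0).Nonempty := by
    by_contra hcon
    rw [Finset.not_nonempty_iff_eq_empty, Finset.filter_eq_empty_iff] at hcon
    obtain ⟨R, hR⟩ := P.isCompact.isBounded.exists_norm_le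
    have hmem : ∀ t : ℝ, 0 ≤ t → x.fst + t • x.snd ∈ halfSpaces P.normal P.offset := by
      intro t ht k
      have h1 : 0 ≤ ⟪P.normal k, x.snd⟫ := not_lt.1 (hcon (Finset.mem_univ k))
      rw [inner_add_right, inner_smul_right]
      have h2 : P.offset k ≤ ⟪P.normal k, x.fst⟫ := hp.1.1 k
      have := mul_nonneg ht h1
      linarith
    have hR0 : 0 ≤ R := (norm_nonneg _).trans (hR _ (hmem 0 le_rfl))
    have hR1 : ‖x.fst‖ ≤ R := hR _ hp.1.1
    have h3 := hR _ (hmem (2 * R + 1) (by linarith))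
    have h4 : ‖(2 * R + 1) • x.snd‖ ≤ ‖x.fst + (2 * R + 1) • x.snd‖ + ‖x.fst‖ := by
      have := norm_sub_le (x.fst + (2 * R + 1) • x.snd) x.fst
      rwa [add_sub_cancel_left] at this
    rw [norm_smul, hv.1, mul_one, Real.norm_eq_abs, abs_of_pos (by linarith)] at h4
    linarith
  obtain ⟨j, hj, hmin⟩ := Finset.exists_min_image _ (fun k => P.hitTime k x) hne
  simp only [Finset.mem_filter, Finset.mem_univ, true_and] at hj hmin
  have hoff : ∀ k, ⟪P.normal k, x.snd⟫ < 0 → 0 < P.hitTime k x := by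
    intro k hk
    have hki : k ≠ i := by
      rintro rfl
      have := hv.2
      rw [real_inner_comm] at this
      linarith
    exact div_pos_of_neg_of_neg (by linarith [hp'.2 k hki]) hk
  have ht := hoff j hj
  have hface : x.fst + P.hitTime j x • x.snd ∈ P.face j := by
    refine ⟨fun k => ?_, ?_⟩
    · rw [inner_add_right, inner_smul_right]
      have h2 : P.offset k ≤ ⟪P.normal k, x.fst⟫ := hp.1.1 k
      rcases lt_or_ge ⟪P.normal k, x.snd⟫ 0 with hk | hk
      · have h3 := mul_le_mul_of_nonpos_right (hmin k hk) hk.le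
        have h4 : P.hitTime k x * ⟪P.normal k, x.snd⟫ = P.offset k - ⟪P.normal k, x.fst⟫ :=
          div_mul_cancel₀ _ hk.ne
        linarith
      · have := mul_nonneg ht.le hk
        linarith
    · rw [inner_add_right, inner_smul_right, hitTime, div_mul_cancel₀ _ hj.ne]
      ring
  refine ⟨i, j, hp, hv, hj, ?_⟩
  by_contra hcon
  exact hsk _ ht.le (Set.mem_iUnion.2 ⟨j, hface, hcon⟩)

variable {P}

namespace Hits
variable {i j : Fin P.N} {x : X d} (h : P.Hits i j x)
include h

lemma inner_pos : 0 < ⟪P.normal i, x.snd⟫ := by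
  rw [real_inner_comm]; exact h.dir_mem.2

lemma ne : j ≠ i := by
  rintro rfl
  exact absurd h.inner_pos (not_lt.2 h.inner_neg.le)

lemma hitTime_pos : 0 < P.hitTime j x :=
  div_pos_of_neg_of_neg (by linarith [(mem_faceInterior_iff.1 h.start_mem).2 j h.ne]) h.inner_neg

lemma flightTime_eq : P.flightTime x = P.hitTime j x := by
  have hp := mem_faceInterior_iff.1 h.start_mem
  have hq := mem_faceInterior_iff.1 h.end_mem
  have hmem : P.hitTime j x ∈ {t : ℝ | 0 < t ∧ ∃ j, x.fst + t • x.snd ∈ P.faceInterior j} :=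
    ⟨h.hitTime_pos, j, h.end_mem⟩
  refine le_antisymm (csInf_le ⟨0, fun t ht => ht.1.le⟩ hmem) (le_csInf ⟨_, hmem⟩ ?_)
  rintro t ⟨ht, k, hk⟩
  -- before the time `hitTime j x` the segment runs in the interior of the polytope
  by_contra hlt
  rw [not_le] at hlt
  have hk' := (mem_faceInterior_iff.1 hk).1
  rw [inner_add_right, inner_smul_right] at hk'
  rcases eq_or_ne k i with rfl | hki
  · have := mul_pos ht h.inner_pos
    linarith [hp.1]
  rcases eq_or_ne k j with rfl | hkj
  · have h1 := hq.1
    rw [inner_add_right, inner_smul_right] at h1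
    have := mul_lt_mul_of_neg_right hlt h.inner_neg
    linarith
  · have h1 := hq.2 k hkj
    have h2 := hp.2 k hki
    rw [inner_add_right, inner_smul_right] at h1
    rcases le_or_gt 0 ⟪P.normal k, x.snd⟫ with h3 | h3
    · have := mul_nonneg ht.le h3
      linarith
    · have := mul_lt_mul_of_neg_right hlt h3
      linarith

lemma normalAt_fst : P.normalAt x.fst = P.normal i := normalAt_eq h.start_mem

lemma normalAt_nextPoint : P.normalAt (P.nextPoint x) = P.normal j := by
  rw [nextPoint, h.flightTime_eq]; exact normalAt_eq h.end_mem

lemma billiardMap_eq (f : ℝ → ℝ) : P.billiardMap f x = WithLp.toLp 2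
    (x.fst + P.hitTime j x • x.snd,
      contract f (P.normal j) (reflect (P.normal j) x.snd)) := by
  rw [billiardMap, h.normalAt_nextPoint, nextPoint, h.flightTime_eq]

lemma reflect_mem : reflect (P.normal j) x.snd ∈ hemisphere (P.normal j) :=
  reflect_mem_hemisphere (P.norm_normal j) h.dir_mem.1 h.inner_neg

lemma billiardMap_mem (hf : IsContractingReflectionLaw f) : P.billiardMap f x ∈ P.M := by
  rw [h.billiardMap_eq]
  exact ⟨j, h.end_mem, contract_mem_hemisphere hf (P.norm_normal j) h.reflect_mem⟩

omit h in
lemma continuousAt_hitTime (h0 : ⟪P.normal j, x.snd⟫ ≠ 0) : ContinuousAt (P.hitTime j) x := by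
  have h1 : Continuous (fun y : X d => y.fst) := WithLp.continuous_fst _ _ _
  have h2 : Continuous (fun y : X d => y.snd) := WithLp.continuous_snd _ _ _
  refine ContinuousAt.div ?_ ?_ h0 <;> fun_prop

/-- Near `x` the faces of departure and of arrival do not change. -/
lemma eventually : ∀ᶠ y in nhdsWithin x P.M, P.Hits i j y := by
  have h1 : Continuous (fun y : X d => y.fst) := WithLp.continuous_fst _ _ _
  have h2 : Continuous (fun y : X d => y.snd) := WithLp.continuous_snd _ _ _
  have hp := mem_faceInterior_iff.1 h.start_mem
  have hq := mem_faceInterior_iff.1 h.end_mem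
  have e1 : ∀ᶠ y : X d in nhds x, ∀ k, k ≠ i → P.offset k < ⟪P.normal k, y.fst⟫ := by
    rw [Filter.eventually_all]
    intro k
    by_cases hk : k = i
    · simp [hk]
    · have : ContinuousAt (fun y : X d => ⟪P.normal k, y.fst⟫) x := by fun_prop
      filter_upwards [this.eventually_const_lt (hp.2 k hk)] with y hy _ using hy
  have e2 : ∀ᶠ y : X d in nhds x, ⟪P.normal j, y.snd⟫ < 0 := by
    have : ContinuousAt (fun y : X d => ⟪P.normal j, y.snd⟫) x := by fun_prop
    exact this.eventually_lt_const h.inner_neg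
  have e3 : ∀ᶠ y : X d in nhds x, ∀ k, k ≠ j →
      P.offset k < ⟪P.normal k, y.fst + P.hitTime j y • y.snd⟫ := by
    rw [Filter.eventually_all]
    intro k
    by_cases hk : k = j
    · simp [hk]
    · have := continuousAt_hitTime (P := P) h.inner_neg.ne
      have : ContinuousAt (fun y : X d => ⟪P.normal k, y.fst + P.hitTime j y • y.snd⟫) x := by
        fun_prop
      filter_upwards [this.eventually_const_lt (hq.2 k hk)] with y hy _ using hy
  filter_upwards [nhdsWithin_le_nhds e1, nhdsWithin_le_nhds e2, nhdsWithin_le_nhds e3,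
    self_mem_nhdsWithin] with y y1 y2 y3 ⟨l, hl, hl'⟩
  have hli : l = i := by
    by_contra hne
    have := y1 l hne
    rw [(mem_faceInterior_iff.1 hl).1] at this
    exact lt_irrefl _ this
  subst hli
  refine ⟨hl, hl', y2, mem_faceInterior_iff.2 ⟨?_, y3⟩⟩
  rw [inner_add_right, inner_smul_right, hitTime, div_mul_cancel₀ _ y2.ne]
  ring

end Hits

variable (P) (f)

/-- The velocity part of the derivative of the billiard map. -/
def velDeriv (x : X d) : E d →L[ℝ] E d :=
  contractDeriv f (P.normalAt (P.nextPoint x)) (reflect (P.normalAt (P.nextPoint x)) x.snd) ∘L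
    reflectL (P.normalAt (P.nextPoint x))

/-- The position part of the derivative of the billiard map: the free flight, followed by the
projection along the direction of flight onto the next face. -/
def posDeriv (x : X d) : X d →L[ℝ] E d :=
  oblique x.snd (P.normalAt (P.nextPoint x)) ∘L
    (WithLp.fstL 2 ℝ (E d) (E d) + P.flightTime x • WithLp.sndL 2 ℝ (E d) (E d))

/-- The derivative of the billiard map, `(u, w) ↦ (A (u + t w), K w)`. -/
def mapDeriv (x : X d) : X d →L[ℝ] X d :=
  (WithLp.prodContinuousLinearEquiv 2 ℝ (E d) (E d)).symm.toContinuousLinearMap ∘L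
    (P.posDeriv x).prod (P.velDeriv f x ∘L WithLp.sndL 2 ℝ (E d) (E d))

lemma mapDeriv_fst (x y : X d) : (P.mapDeriv f x y).fst =
    oblique x.snd (P.normalAt (P.nextPoint x)) (y.fst + P.flightTime x • y.snd) := rfl

lemma mapDeriv_snd (x y : X d) : (P.mapDeriv f x y).snd = P.velDeriv f x y.snd := rfl

variable {P f}

lemma Hits.hasFDerivWithinAt {i j : Fin P.N} {x : X d} (h : P.Hits i j x)
    (hf : IsContractingReflectionLaw f) :
    HasFDerivWithinAt (P.billiardMap f) (P.mapDeriv f x) P.M x := by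
  set F := WithLp.fstL 2 ℝ (E d) (E d) with hF
  set S := WithLp.sndL 2 ℝ (E d) (E d) with hS
  have hFx : HasFDerivAt (fun y : X d => y.fst) F x := F.hasFDerivAt
  have hSx : HasFDerivAt (fun y : X d => y.snd) S x := S.hasFDerivAt
  have hnum : HasFDerivAt (fun y : X d => P.offset j - ⟪P.normal j, y.fst⟫)
      (-(innerSL ℝ (P.normal j) ∘L F)) x :=
    ((innerSL ℝ (P.normal j)).hasFDerivAt.comp x hFx).const_sub _
  have hden : HasFDerivAt (fun y : X d => ⟪P.normal j, y.snd⟫)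
      (innerSL ℝ (P.normal j) ∘L S) x :=
    (innerSL ℝ (P.normal j)).hasFDerivAt.comp x hSx
  have hneg := h.inner_neg.ne
  have ht : HasFDerivAt (P.hitTime j) _ x :=
    hnum.mul ((hasDerivAt_inv hneg).comp_hasFDerivAt x hden)
  have hpos := hFx.add (ht.smul hSx)
  have hR : HasFDerivAt (fun y : X d => reflect (P.normal j) y.snd)
      (reflectL (P.normal j) ∘L S) x := by
    have := (reflectL (P.normal j)).hasFDerivAt.comp x hSx
    refine this.congr_of_eventuallyEq (Filter.Eventually.of_forall fun y => ?_)
    simp [reflectL_apply]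
  have hvel := (hasFDerivAt_contractExt hf (P.normal j)
    (perp_mem_ball (P.norm_normal j) h.reflect_mem)).comp x hR
  have hpair := ((WithLp.prodContinuousLinearEquiv 2 ℝ (E d) (E d)).symm.hasFDerivAt.comp x
    (hpos.prodMk hvel)).hasFDerivWithinAt (s := P.M)
  refine (hpair.congr_of_eventuallyEq ?_ ?_).congr_fderiv ?_
  · filter_upwards [h.eventually] with y hy
    rw [hy.billiardMap_eq, contract_eq_contractExt hf (P.norm_normal j) hy.reflect_mem]
    rfl
  · rw [h.billiardMap_eq, contract_eq_contractExt hf (P.norm_normal j) h.reflect_mem]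
    rfl
  · ext1 y
    have hT : P.hitTime j x * ⟪P.normal j, x.snd⟫ = P.offset j - ⟪P.normal j, x.fst⟫ :=
      div_mul_cancel₀ _ hneg
    rw [mapDeriv, posDeriv, velDeriv, h.normalAt_nextPoint, h.flightTime_eq]
    simp only [ContinuousLinearMap.comp_apply, ContinuousLinearMap.prod_apply]
    congr 1
    refine Prod.ext ?_ rfl
    simp [oblique_apply, hF, hS, inner_add_right, inner_smul_right]
    rw [← hT, add_sub_assoc, add_right_inj, sub_eq_add_neg, add_right_inj, ← neg_smul]
    congr 1
    field_simp
    ring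

lemma hasFDerivWithinAt_billiardMap (hf : IsContractingReflectionLaw f) {x : X d}
    (hx : x ∈ P.M') : HasFDerivWithinAt (P.billiardMap f) (P.mapDeriv f x) P.M x := by
  obtain ⟨i, j, h⟩ := P.exists_hits hx
  exact h.hasFDerivWithinAt hf

end Polytope

/-! ### Tangent spaces, iterates and continuity -/

/- The topological instances on the space of pairs are given directly: the search through its norm is
very slow. -/

instance : ContinuousSMul ℝ (X d) := ⟨(WithLp.prod_continuous_toLp 2 (E d) (E d)).comp
  ((continuous_fst.smul ((WithLp.continuous_fst 2 (E d) (E d)).comp continuous_snd)).prodMk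
   (continuous_fst.smul ((WithLp.continuous_snd 2 (E d) (E d)).comp continuous_snd)))⟩

instance : ContinuousAdd (X d) := ⟨(WithLp.prod_continuous_toLp 2 (E d) (E d)).comp
  (((WithLp.continuous_fst 2 (E d) (E d)).comp continuous_fst |>.add
     ((WithLp.continuous_fst 2 (E d) (E d)).comp continuous_snd)).prodMk
   ((WithLp.continuous_snd 2 (E d) (E d)).comp continuous_fst |>.add
     ((WithLp.continuous_snd 2 (E d) (E d)).comp continuous_snd)))⟩

instance : IsTopologicalAddGroup (X d) where
  continuous_neg := (WithLp.prod_continuous_toLp 2 (E d) (E d)).comp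
    ((WithLp.continuous_fst 2 (E d) (E d)).neg.prodMk (WithLp.continuous_snd 2 (E d) (E d)).neg)

namespace Polytope
variable {P : Polytope d}

lemma mem_tangent_iff {x y : X d} : y ∈ P.tangent x ↔
    ⟪y.fst, P.normalAt x.fst⟫ = 0 ∧ ⟪y.snd, x.snd⟫ = 0 := Iff.rfl

/-- Every tangent vector is the velocity of a curve in `M`, so derivatives within `M` are determined
on the tangent space. -/
lemma tangent_subset_tangentConeAt {x : X d} (hx : x ∈ P.M) :
    (P.tangent x : Set (X d)) ⊆ tangentConeAt ℝ P.M x := by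
  obtain ⟨i, hp, hv⟩ := hx
  rintro y ⟨hy1, hy2⟩
  rw [normalAt_eq hp] at hy1
  have hp' := mem_faceInterior_iff.1 hp
  set c : ℝ → X d := fun s => WithLp.toLp 2 (x.fst + s • y.fst,
    (√(1 + s ^ 2 * ‖y.snd‖ ^ 2))⁻¹ • (x.snd + s • y.snd)) with hc
  have hpos : ∀ s : ℝ, 0 < 1 + s ^ 2 * ‖y.snd‖ ^ 2 := fun s => by positivity
  have hc0 : c 0 = x := by simp [hc]; rfl
  have hder : HasDerivAt c y 0 := by
    have h1 : HasDerivAt (fun s : ℝ => x.fst + s • y.fst) y.fst 0 := by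
      simpa using ((hasDerivAt_id (0 : ℝ)).smul_const y.fst).const_add x.fst
    have h2 : HasDerivAt (fun s : ℝ => x.snd + s • y.snd) y.snd 0 := by
      simpa using ((hasDerivAt_id (0 : ℝ)).smul_const y.snd).const_add x.snd
    have h3 : HasDerivAt (fun s : ℝ => 1 + s ^ 2 * ‖y.snd‖ ^ 2) 0 0 := by
      simpa using (((hasDerivAt_id (0 : ℝ)).pow 2).mul_const (‖y.snd‖ ^ 2)).const_add 1
    have h4 : HasDerivAt (fun s : ℝ => (√(1 + s ^ 2 * ‖y.snd‖ ^ 2))⁻¹) 0 0 := by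
      have := (h3.sqrt (hpos 0).ne').inv (Real.sqrt_pos.2 (hpos 0)).ne'
      exact this.congr_deriv (by simp)
    have h5 : HasDerivAt (fun s : ℝ => (√(1 + s ^ 2 * ‖y.snd‖ ^ 2))⁻¹ • (x.snd + s • y.snd))
        y.snd 0 := by
      exact (h4.smul h2).congr_deriv (by simp)
    exact (WithLp.prodContinuousLinearEquiv 2 ℝ (E d) (E d)).symm.hasFDerivAt.comp_hasDerivAt
      (0 : ℝ) (h1.prodMk h5)
  have hmem : c ⁻¹' P.M ∈ nhds (0 : ℝ) := by
    have e1 : ∀ᶠ s : ℝ in nhds 0, ∀ k, k ≠ i → P.offset k < ⟪P.normal k, x.fst + s • y.fst⟫ := by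
      rw [Filter.eventually_all]
      intro k
      by_cases hk : k = i
      · simp [hk]
      · have hcont : ContinuousAt (fun s : ℝ => ⟪P.normal k, x.fst + s • y.fst⟫) 0 := by fun_prop
        have h0 : P.offset k < ⟪P.normal k, x.fst + (0 : ℝ) • y.fst⟫ := by
          simpa using hp'.2 k hk
        filter_upwards [hcont.eventually_const_lt h0] with s hs _ using hs
    have e2 : ∀ᶠ s : ℝ in nhds 0, 0 < ⟪x.snd + s • y.snd, P.normal i⟫ := by
      have hcont : ContinuousAt (fun s : ℝ => ⟪x.snd + s • y.snd, P.normal i⟫) 0 := by fun_prop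
      exact hcont.eventually_const_lt (by simpa using hv.2)
    filter_upwards [e1, e2] with s s1 s2
    refine ⟨i, mem_faceInterior_iff.2 ⟨?_, s1⟩, ?_, ?_⟩
    · change ⟪P.normal i, x.fst + s • y.fst⟫ = _
      rw [inner_add_right, inner_smul_right, real_inner_comm y.fst, hy1, hp'.1]
      simp
    · change ‖(√(1 + s ^ 2 * ‖y.snd‖ ^ 2))⁻¹ • (x.snd + s • y.snd)‖ = 1
      have h1 : ‖x.snd + s • y.snd‖ ^ 2 = 1 + s ^ 2 * ‖y.snd‖ ^ 2 := by
        rw [norm_add_sq_real, inner_smul_right, real_inner_comm, hy2, norm_smul, hv.1,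
          mul_pow, Real.norm_eq_abs, sq_abs]
        ring
      rw [norm_smul, ← h1, Real.sqrt_sq (norm_nonneg _), norm_inv, norm_norm]
      refine inv_mul_cancel₀ fun h0 => ?_
      rw [h0] at h1
      linarith [hpos s]
    · change 0 < ⟪(√(1 + s ^ 2 * ‖y.snd‖ ^ 2))⁻¹ • (x.snd + s • y.snd), P.normal i⟫
      rw [inner_smul_left]
      exact mul_pos (inv_pos.2 (Real.sqrt_pos.2 (hpos s))) s2
  have h := (hder.hasFDerivAt.hasFDerivWithinAt (s := c ⁻¹' P.M)).mapsTo_tangent_cone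
  rw [tangentConeAt_of_mem_nhds hmem, hc0] at h
  have := h (Set.mem_univ (1 : ℝ))
  refine tangentConeAt_mono (Set.image_preimage_subset c P.M) ?_
  simpa using this

lemma inner_oblique {v n : E d} (h : ⟪n, v⟫ ≠ 0) (z : E d) : ⟪n, oblique v n z⟫ = 0 := by
  rw [oblique_apply, inner_sub_right, inner_smul_right]
  field_simp
  ring

lemma mapDeriv_mem_tangent (hf : IsContractingReflectionLaw f) {x y : X d} (hx : x ∈ P.M') :
    P.mapDeriv f x y ∈ P.tangent (P.billiardMap f x) := by
  obtain ⟨i, j, h⟩ := P.exists_hits hx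
  have h1 : P.normalAt (P.billiardMap f x).fst = P.normal j := h.normalAt_nextPoint
  rw [mem_tangent_iff, mapDeriv_fst, mapDeriv_snd, h1, h.normalAt_nextPoint]
  constructor
  · rw [real_inner_comm, inner_oblique h.inner_neg.ne]
  · rw [velDeriv, h.normalAt_nextPoint, h.billiardMap_eq]
    exact inner_contract_contractDeriv hf (P.norm_normal j) h.reflect_mem _

variable (P f) in
/-- The derivative of the `n`-th iterate of the billiard map, by the chain rule. -/
def orbitDeriv : ℕ → X d → X d →L[ℝ] X d
  | 0, _ => ContinuousLinearMap.id ℝ (X d)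
  | n + 1, x => P.mapDeriv f ((P.billiardMap f)^[n] x) ∘L orbitDeriv n x

lemma hasFDerivWithinAt_iterate (hf : IsContractingReflectionLaw f) {x : X d}
    (hx : ∀ n, (P.billiardMap f)^[n] x ∈ P.M') (n : ℕ) :
    HasFDerivWithinAt ((P.billiardMap f)^[n]) (P.orbitDeriv f n x) P.M x ∧
      ∀ᶠ y in nhdsWithin x P.M, (P.billiardMap f)^[n] y ∈ P.M := by
  induction n with
  | zero => exact ⟨hasFDerivWithinAt_id x P.M, self_mem_nhdsWithin⟩
  | succ n ih =>
    obtain ⟨i, j, h⟩ := P.exists_hits (hx n)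
    have ht : Filter.Tendsto (P.billiardMap f)^[n] (nhdsWithin x P.M)
        (nhdsWithin ((P.billiardMap f)^[n] x) P.M) :=
      tendsto_nhdsWithin_iff.2 ⟨ih.1.continuousWithinAt, ih.2⟩
    rw [Function.iterate_succ']
    refine ⟨(h.hasFDerivWithinAt hf).comp_of_tendsto x ih.1 ht, ?_⟩
    filter_upwards [ht.eventually h.eventually] with y hy using hy.billiardMap_mem hf

lemma DPhi_apply (hf : IsContractingReflectionLaw f) {x y : X d}
    (hx : x ∈ P.MPlus f) (n : ℕ) (hy : y ∈ P.tangent x) :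
    P.DPhi f n x y = P.orbitDeriv f n x y := by
  have h := (hasFDerivWithinAt_iterate hf hx.2 n).1
  exact h.differentiableWithinAt.hasFDerivWithinAt.unique_on h
    (tangent_subset_tangentConeAt hx.1 hy)

variable (P) in
/-- The projection along the direction of flight onto the face of departure. On the next face it
inverts the action of the derivative of the billiard map on positions. -/
def backProj (x : X d) : E d →L[ℝ] E d := oblique x.snd (P.normalAt x.fst)

lemma continuousWithinAt_billiardMap (hf : IsContractingReflectionLaw f) {x : X d}
    (hx : x ∈ P.M') : ContinuousWithinAt (P.billiardMap f) P.M x :=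
  (hasFDerivWithinAt_billiardMap hf hx).continuousWithinAt

lemma continuousWithinAt_flightTime {x : X d} (hx : x ∈ P.M') :
    ContinuousWithinAt P.flightTime P.M x := by
  obtain ⟨i, j, h⟩ := P.exists_hits hx
  refine (Hits.continuousAt_hitTime h.inner_neg.ne).continuousWithinAt.congr_of_eventuallyEq
    ?_ h.flightTime_eq
  filter_upwards [h.eventually] with y hy using hy.flightTime_eq

lemma continuousWithinAt_normalAt {x : X d} (hx : x ∈ P.M') :
    ContinuousWithinAt (fun y : X d => P.normalAt y.fst) P.M x := by
  obtain ⟨i, j, h⟩ := P.exists_hits hx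
  refine (continuousWithinAt_const (b := P.normal i)).congr_of_eventuallyEq ?_ h.normalAt_fst
  filter_upwards [h.eventually] with y hy using hy.normalAt_fst

lemma continuous_velocity : Continuous (fun y : X d => y.snd) := WithLp.continuous_snd _ _ _

lemma continuousWithinAt_backProj {x : X d} (hx : x ∈ P.M') :
    ContinuousWithinAt P.backProj P.M x := by
  obtain ⟨i, j, h⟩ := P.exists_hits hx
  have h1 : ContinuousAt (fun y : X d => oblique y.snd (P.normal i)) x :=
    (continuousAt_oblique h.inner_pos.ne').comp (f := fun y : X d => y.snd)
      continuous_velocity.continuousAt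
  refine h1.continuousWithinAt.congr_of_eventuallyEq ?_ (by rw [backProj, h.normalAt_fst])
  filter_upwards [h.eventually] with y hy
  rw [backProj, hy.normalAt_fst]

lemma continuousWithinAt_velDeriv (hf : IsContractingReflectionLaw f) {x : X d}
    (hx : x ∈ P.M') : ContinuousWithinAt (P.velDeriv f) P.M x := by
  obtain ⟨i, j, h⟩ := P.exists_hits hx
  have ho : IsOpen (perp (P.normal j) ⁻¹' Metric.ball (0 : E d) 1) :=
    Metric.isOpen_ball.preimage (perp (P.normal j)).continuous
  have h1 : ContinuousAt (contractDeriv f (P.normal j)) (reflect (P.normal j) x.snd) :=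
    (continuousOn_contractDeriv hf (P.normal j)).continuousAt
      (ho.mem_nhds (perp_mem_ball (P.norm_normal j) h.reflect_mem))
  have h2 : ContinuousAt (fun y : X d => reflect (P.normal j) y.snd) x := by
    simp only [← reflectL_apply]
    exact ((reflectL (P.normal j)).continuous.comp continuous_velocity).continuousAt
  have h3 : ContinuousAt (fun y : X d =>
      contractDeriv f (P.normal j) (reflect (P.normal j) y.snd) ∘L reflectL (P.normal j)) x :=
    (ContinuousAt.comp (f := fun y : X d => reflect (P.normal j) y.snd) h1 h2).clm_comp
      continuousAt_const
  refine h3.continuousWithinAt.congr_of_eventuallyEq ?_ (by rw [velDeriv, h.normalAt_nextPoint])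
  filter_upwards [h.eventually] with y hy
  rw [velDeriv, hy.normalAt_nextPoint]

end Polytope

/-! ### Growth of the transverse component -/

section Transport

variable {V : Type*} [NormedAddCommGroup V] [InnerProductSpace ℝ V]

/-- The squared length of the component of `u` orthogonal to the unit vector `v`. -/
def transverse (u v : V) : ℝ := ‖u‖ ^ 2 - ⟪u, v⟫ ^ 2

lemma transverse_nonneg {u v : V} (hv : ‖v‖ = 1) : 0 ≤ transverse u v := by
  have h := abs_real_inner_le_norm u v
  rw [hv, mul_one] at h
  have := pow_le_pow_left₀ (abs_nonneg _) h 2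
  rw [sq_abs] at this
  unfold transverse
  linarith

lemma transverse_le (u v : V) : transverse u v ≤ ‖u‖ ^ 2 := by
  unfold transverse
  nlinarith [sq_nonneg ⟪u, v⟫]

lemma transverse_add_smul {u v : V} (hv : ‖v‖ = 1) (c : ℝ) :
    transverse (u + c • v) v = transverse u v := by
  unfold transverse
  rw [norm_add_sq_real, inner_add_left, inner_smul_left, inner_smul_right, norm_smul,
    real_inner_self_eq_norm_sq, hv, mul_pow, Real.norm_eq_abs, sq_abs]
  simp only [conj_trivial]
  ring

lemma transverse_smul (u v : V) (a : ℝ) : transverse (a • u) v = a ^ 2 * transverse u v := by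
  unfold transverse
  rw [norm_smul, inner_smul_left, mul_pow, Real.norm_eq_abs, sq_abs]
  simp only [conj_trivial]
  ring

/-- The sequences `n k` of normals, `v k` of velocities and `u k` of infinitesimal displacements of
the base point along an orbit of a contracting billiard: displacements are projected along the
velocity onto the next face, and at each collision the component of the velocity along the face is
multiplied by a factor `g k` of absolute value at most `l`. -/
structure IsTransport (l : ℝ) (n v u : ℕ → V) (g c : ℕ → ℝ) : Prop where
  norm_normal : ∀ k, ‖n k‖ = 1
  norm_velocity : ∀ k, ‖v k‖ = 1
  inner_eq_zero : ∀ k, ⟪n k, u k⟫ = 0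
  step : ∀ k, u (k + 1) = u k + c k • v k
  abs_factor_le : ∀ k, |g k| ≤ l
  collision : ∀ k, ∃ r : ℝ, v (k + 1) = g k • v k + r • n (k + 1)

namespace IsTransport
variable {l : ℝ} {n v u : ℕ → V} {g c : ℕ → ℝ} (h : IsTransport l n v u g c)
include h

lemma inner_velocity_succ (k : ℕ) : ⟪u (k + 1), v (k + 1)⟫ = g k * ⟪u (k + 1), v k⟫ := by
  obtain ⟨r, hr⟩ := h.collision k
  rw [hr, inner_add_right, inner_smul_right, inner_smul_right, real_inner_comm (n (k + 1)),
    h.inner_eq_zero]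
  ring

lemma factor_sq_le (k : ℕ) : g k ^ 2 ≤ l ^ 2 := by
  rw [← sq_abs (g k)]
  exact pow_le_pow_left₀ (abs_nonneg _) (h.abs_factor_le k) 2

lemma transverse_succ (k : ℕ) : transverse (u (k + 1)) (v (k + 1)) =
    transverse (u k) (v k) + (1 - g k ^ 2) * ⟪u (k + 1), v k⟫ ^ 2 := by
  have h1 : transverse (u (k + 1)) (v k) = transverse (u k) (v k) := by
    rw [h.step, transverse_add_smul (h.norm_velocity k)]
  rw [← h1, transverse, h.inner_velocity_succ, transverse]
  ring

lemma step_eq (k : ℕ) : c k = ⟪u (k + 1), v k⟫ - ⟪u k, v k⟫ := by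
  rw [h.step, inner_add_left, inner_smul_left, real_inner_self_eq_norm_sq, h.norm_velocity]
  simp

lemma rate_nonneg : 0 ≤ l := (abs_nonneg _).trans (h.abs_factor_le 0)

lemma rate_sq_lt_one (hl : l < 1) : l ^ 2 < 1 := by
  have := h.rate_nonneg
  nlinarith [hl]

lemma transverse_succ_ge (k : ℕ) :
    transverse (u k) (v k) + (1 - l ^ 2) * ⟪u (k + 1), v k⟫ ^ 2 ≤
      transverse (u (k + 1)) (v (k + 1)) := by
  rw [h.transverse_succ]
  have := h.factor_sq_le k
  nlinarith [sq_nonneg ⟪u (k + 1), v k⟫]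

lemma transverse_monotone (hl : l < 1) : Monotone fun k => transverse (u k) (v k) := by
  refine monotone_nat_of_le_succ fun k => ?_
  have := h.transverse_succ_ge k
  have := mul_nonneg (sub_nonneg.2 (h.rate_sq_lt_one hl).le) (sq_nonneg ⟪u (k + 1), v k⟫)
  linarith

/- If the transverse component hardly grows up to time `T`, then the displacements are almost
orthogonal to the velocities and almost constant in norm. -/

section Small
variable {δ : ℝ} {T : ℕ} (hl : l < 1) (hδ : 0 < δ) (h0 : transverse (u 0) (v 0) = 1)
  (hT : transverse (u T) (v T) ≤ 1 + (1 - l ^ 2) * δ ^ 2)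
include hl hδ h0 hT

lemma abs_inner_le {k : ℕ} (hk : k + 1 ≤ T) : |⟪u (k + 1), v k⟫| ≤ δ := by
  have h1 := h.transverse_succ_ge k
  have h2 := h.transverse_monotone hl hk
  have h3 := h.transverse_monotone hl (Nat.zero_le k)
  simp only [h0] at h2 h3
  have h4 : 0 < 1 - l ^ 2 := by linarith [h.rate_sq_lt_one hl]
  refine abs_le_of_sq_le_sq ?_ hδ.le
  refine le_of_mul_le_mul_left ?_ h4
  linarith

lemma abs_inner_self_le {k : ℕ} (hk1 : 1 ≤ k) (hk : k ≤ T) : |⟪u k, v k⟫| ≤ δ := by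
  obtain ⟨k, rfl⟩ := Nat.exists_eq_add_of_le' hk1
  rw [h.inner_velocity_succ, abs_mul]
  have := h.abs_inner_le hl hδ h0 hT hk
  have := (h.abs_factor_le k).trans hl.le
  calc |g k| * |⟪u (k + 1), v k⟫| ≤ 1 * δ := by gcongr
    _ = δ := one_mul δ

lemma abs_step_le {k : ℕ} (hk1 : 1 ≤ k) (hk : k + 1 ≤ T) : |c k| ≤ 2 * δ := by
  rw [h.step_eq]
  have h1 := h.abs_inner_le hl hδ h0 hT hk
  have h2 := h.abs_inner_self_le hl hδ h0 hT hk1 (by omega)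
  have := abs_sub ⟪u (k + 1), v k⟫ ⟪u k, v k⟫
  linarith

omit hδ hT in
lemma one_le_norm_sq (k : ℕ) : 1 ≤ ‖u k‖ ^ 2 := by
  have h3 := h.transverse_monotone hl (Nat.zero_le k)
  simp only [h0] at h3
  exact h3.trans (transverse_le _ _)

lemma norm_sq_le {k : ℕ} (hk1 : 1 ≤ k) (hk : k ≤ T) : ‖u k‖ ^ 2 ≤ 1 + 2 * δ ^ 2 := by
  have h2 := h.transverse_monotone hl hk
  have h3 := h.abs_inner_self_le hl hδ h0 hT hk1 hk
  have h4 := pow_le_pow_left₀ (abs_nonneg _) h3 2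
  rw [sq_abs] at h4
  simp only at h2
  unfold transverse at h2 hT
  nlinarith [sq_nonneg l, sq_nonneg δ, mul_nonneg (sq_nonneg l) (sq_nonneg δ)]

end Small

/-- The component of the velocity orthogonal to a subspace decays geometrically as long as the
orbit only visits faces with normals in that subspace. -/
lemma norm_starProjection_velocity_le [FiniteDimensional ℝ V] {W : Submodule ℝ V} {m i : ℕ}
    (hW : ∀ k, m < k → k ≤ m + i → n k ∈ W) : ‖Wᗮ.starProjection (v (m + i))‖ ≤ l ^ i := by
  induction i with
  | zero =>
    simpa [h.norm_velocity] using Wᗮ.norm_starProjection_apply_le (v m)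
  | succ i ih =>
    obtain ⟨r, hr⟩ := h.collision (m + i)
    have hn : Wᗮ.starProjection (n (m + i + 1)) = 0 :=
      Submodule.starProjection_orthogonal_apply_eq_zero (hW _ (by omega) (by omega))
    rw [← add_assoc, hr, map_add, map_smul, map_smul, hn, smul_zero, add_zero, norm_smul,
      Real.norm_eq_abs, pow_succ']
    have := ih fun k h1 h2 => hW k h1 (by omega)
    have := h.abs_factor_le (m + i)
    have := h.rate_nonneg
    gcongr

/-- As long as the orbit only visits faces with normals in a subspace, the component of the
displacement orthogonal to that subspace drifts by a bounded amount, however long the time. -/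
lemma norm_starProjection_drift_le [FiniteDimensional ℝ V] (hl : l < 1) {W : Submodule ℝ V}
    {m i : ℕ} {B : ℝ} (hW : ∀ k, m < k → k ≤ m + i → n k ∈ W)
    (hB : ∀ k, m ≤ k → k < m + i → |c k| ≤ B) (hB0 : 0 ≤ B) :
    ‖Wᗮ.starProjection (u (m + i)) - Wᗮ.starProjection (u m)‖ ≤ B / (1 - l) := by
  have hl0 := h.rate_nonneg
  have key : ∀ j, j ≤ i → ‖Wᗮ.starProjection (u (m + j)) - Wᗮ.starProjection (u m)‖ ≤
      B * ∑ k ∈ Finset.range j, l ^ k := by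
    intro j
    induction j with
    | zero => simp
    | succ j ih =>
      intro hj
      have h1 := ih (by omega)
      have h2 := h.norm_starProjection_velocity_le (W := W) (m := m) (i := j)
        fun k h1 h2 => hW k h1 (by omega)
      have h3 := hB (m + j) (by omega) (by omega)
      rw [← add_assoc, h.step, map_add, map_smul, Finset.sum_range_succ, mul_add,
        add_sub_right_comm]
      refine (norm_add_le _ _).trans (add_le_add h1 ?_)
      rw [norm_smul, Real.norm_eq_abs]
      gcongr
  refine (key i le_rfl).trans ?_
  rw [div_eq_mul_inv]
  refine mul_le_mul_of_nonneg_left ?_ hB0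
  rw [← tsum_geometric_of_lt_one hl0 hl]
  exact (summable_geometric_of_lt_one hl0 hl).sum_le_tsum _ fun k _ => by positivity

end IsTransport

/-- A vector orthogonal to `η` that is almost orthogonal to `W` is almost orthogonal to the span of
`W` and `η`. The factor is finite even for `η ∈ W`, where the inverse is `0`. -/
lemma norm_starProjection_sup_le [FiniteDimensional ℝ V] {W U : Submodule ℝ V} {η u : V}
    (hU : U = W ⊔ Submodule.span ℝ {η}) (hη : ‖η‖ = 1) (hu : ⟪η, u⟫ = 0) :
    ‖U.starProjection u‖ ≤
      (1 + ‖η - W.starProjection η‖⁻¹) * ‖W.starProjection u‖ := by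
  set e := η - W.starProjection η with he
  set z := U.starProjection u with hz
  have hzU : z ∈ U := U.starProjection_apply_mem u
  have hWη := W.starProjection_apply_mem η
  rcases eq_or_ne e 0 with h0 | h0
  · have hηW : η ∈ W := by rw [sub_eq_zero.1 h0]; exact hWη
    obtain rfl : U = W := hU.trans (sup_eq_left.2 (by simpa using hηW))
    rw [hz, h0]
    simp
  have he0 : 0 < ‖e‖ := norm_pos_iff.2 h0
  obtain ⟨w, hw, y, hy, hwy⟩ := Submodule.mem_sup.1 (hU ▸ hzU)
  obtain ⟨t, rfl⟩ := Submodule.mem_span_singleton.1 hy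
  set w' := w + t • W.starProjection η with hw'
  have hw'W : w' ∈ W := W.add_mem hw (W.smul_mem t hWη)
  have hzeq : z = w' + t • e := by rw [← hwy, hw', he, smul_sub]; abel
  have hew : ⟪w', e⟫ = 0 := by
    rw [real_inner_comm]; exact W.starProjection_inner_eq_zero η w' hw'W
  have hzn : ‖z‖ ^ 2 = ‖w'‖ ^ 2 + t ^ 2 * ‖e‖ ^ 2 := by
    rw [hzeq, norm_add_sq_real, inner_smul_right, hew, norm_smul, mul_pow, Real.norm_eq_abs,
      sq_abs]
    ring
  have hzu : ‖z‖ ^ 2 = ⟪z, u⟫ := by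
    have := U.starProjection_inner_eq_zero u z hzU
    rw [inner_sub_left, sub_eq_zero] at this
    rw [real_inner_comm, this, real_inner_self_eq_norm_sq]
  have hPu : ∀ a ∈ W, ⟪a, u⟫ = ⟪a, W.starProjection u⟫ := by
    intro a ha
    have := W.starProjection_inner_eq_zero u a ha
    rw [inner_sub_left, sub_eq_zero] at this
    rw [real_inner_comm, this, real_inner_comm]
  have heu : ⟪e, u⟫ = -⟪η, W.starProjection u⟫ := by
    rw [he, inner_sub_left, hu, W.inner_starProjection_left_eq_right, zero_sub]
  have hsum : ‖z‖ ^ 2 = ⟪w', W.starProjection u⟫ - t * ⟪η, W.starProjection u⟫ := by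
    rw [hzu, hzeq, inner_add_left, inner_smul_left, hPu w' hw'W, heu]
    simp only [conj_trivial]
    ring
  have h1 : ‖w'‖ ≤ ‖z‖ := by
    refine le_of_sq_le_sq ?_ (norm_nonneg z)
    rw [hzn]; nlinarith [mul_nonneg (sq_nonneg t) (sq_nonneg ‖e‖)]
  have h2 : |t| ≤ ‖z‖ * ‖e‖⁻¹ := by
    rw [← div_eq_mul_inv, le_div_iff₀ he0]
    refine le_of_sq_le_sq ?_ (norm_nonneg z)
    rw [hzn, mul_pow, sq_abs]; nlinarith [sq_nonneg ‖w'‖]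
  have h3 : |⟪η, W.starProjection u⟫| ≤ ‖W.starProjection u‖ := by
    have := abs_real_inner_le_norm η (W.starProjection u)
    rwa [hη, one_mul] at this
  have h4 : ‖z‖ ^ 2 ≤ ‖z‖ * ((1 + ‖e‖⁻¹) * ‖W.starProjection u‖) := by
    rw [hsum]
    have h5 := (le_abs_self _).trans (abs_real_inner_le_norm w' (W.starProjection u))
    have h6 : -(t * ⟪η, W.starProjection u⟫) ≤ |t| * |⟪η, W.starProjection u⟫| := by
      rw [← abs_mul]; exact neg_le_abs _
    have h7 : |t| * |⟪η, W.starProjection u⟫| ≤ ‖z‖ * ‖e‖⁻¹ * ‖W.starProjection u‖ := by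
      gcongr
    have h8 : ‖w'‖ * ‖W.starProjection u‖ ≤ ‖z‖ * ‖W.starProjection u‖ := by gcongr
    linarith
  rcases (norm_nonneg z).eq_or_lt with hz0 | hz0
  · rw [← hz0]; positivity
  · rw [sq] at h4
    exact le_of_mul_le_mul_left h4 hz0

/-- The span of the normals `N (i 1), …, N (i m)`. -/
def visited {ι : Type*} (N : ι → V) (i : ℕ → ι) (m : ℕ) : Submodule ℝ V :=
  Submodule.span ℝ (N '' (i '' Set.Icc 1 m))

section visited
variable {ι : Type*} (N : ι → V) (i : ℕ → ι)

lemma visited_mono : Monotone (visited N i) := fun _ _ h =>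
  Submodule.span_mono (Set.image_mono (Set.image_mono (Set.Icc_subset_Icc_right h)))

lemma mem_visited {k m : ℕ} (h1 : 1 ≤ k) (h2 : k ≤ m) : N (i k) ∈ visited N i m :=
  Submodule.subset_span ⟨_, ⟨k, ⟨h1, h2⟩, rfl⟩, rfl⟩

lemma visited_succ (m : ℕ) :
    visited N i (m + 1) = visited N i m ⊔ Submodule.span ℝ {N (i (m + 1))} := by
  have : Set.Icc 1 (m + 1) = Set.Icc 1 m ∪ {m + 1} := by
    ext k; simp only [Set.mem_Icc, Set.mem_union, Set.mem_singleton_iff]; omega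
  rw [visited, visited, this, Set.image_union, Set.image_union, Submodule.span_union]
  simp

end visited

/-- The numerical step of `exists_tolerance`: `A` and `x` are the norms of the components of the
displacement in the span `W` of the visited normals and orthogonal to it, `A'` and `y` those at the
time when the span became `W`, and `D` bounds the drift in between. -/
lemma sq_le_of_drift {n n' A A' x y D δ κ : ℝ} (e1 : n = A ^ 2 + x ^ 2)
    (e2 : n' = A' ^ 2 + y ^ 2) (e3 : n ≤ 1 + 2 * δ ^ 2) (e4 : 1 ≤ n') (e5 : n' ≤ 1 + 2 * δ ^ 2)
    (hy : 0 ≤ y) (hxy : y ≤ x + D) (hδ : 0 ≤ δ) (hδ1 : δ ≤ 1)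
    (hδD : 2 * δ ≤ D) (hD : D ≤ κ ^ 2 / 20) (hA : A' ^ 2 ≤ (κ / 2) ^ 2) : A ^ 2 ≤ κ ^ 2 := by
  have hδ2 : δ ^ 2 ≤ δ := by nlinarith
  have hy2 : y ≤ 2 := le_of_sq_le_sq (by linarith [sq_nonneg A']) (by norm_num)
  have hD0 : 0 ≤ D := by linarith
  have hsq : y ^ 2 - 4 * D ≤ x ^ 2 := by
    rcases le_total y D with hc | hc
    · nlinarith [mul_le_mul hy2 hc hy zero_le_two, sq_nonneg x]
    · have := pow_le_pow_left₀ (sub_nonneg.2 hc) (sub_le_iff_le_add.2 hxy) 2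
      nlinarith [mul_le_mul_of_nonneg_right hy2 hD0, sq_nonneg D]
  linarith

/-- If the transverse component hardly grows, the displacement is almost orthogonal to all normals
visited so far. The tolerance does not depend on the time: between two visits to new directions
only the drift of `IsTransport.norm_starProjection_drift_le` matters, and there are at most
`dim V` such visits. -/
lemma exists_tolerance [FiniteDimensional ℝ V] {ι : Type*} [Finite ι] (N : ι → V) {l : ℝ}
    (hl0 : 0 ≤ l) (hl : l < 1) (r : ℕ) :
    ∀ κ : ℝ, 0 < κ → ∃ δ₀ : ℝ, 0 < δ₀ ∧ ∀ δ : ℝ, 0 < δ → δ ≤ δ₀ →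
      ∀ (i : ℕ → ι) (v u : ℕ → V) (g c : ℕ → ℝ),
        IsTransport l (fun k => N (i k)) v u g c → transverse (u 0) (v 0) = 1 →
        ∀ T : ℕ, transverse (u T) (v T) ≤ 1 + (1 - l ^ 2) * δ ^ 2 →
        ∀ m : ℕ, 1 ≤ m → m ≤ T → Module.finrank ℝ (visited N i m) ≤ r →
          ‖(visited N i m).starProjection (u m)‖ ≤ κ := by
  induction r with
  | zero =>
    intro κ hκ
    refine ⟨1, one_pos, fun δ _ _ i v u g c h _ T _ m h1 _ hr => ?_⟩
    exfalso
    have hbot : visited N i m = ⊥ := Submodule.finrank_eq_zero.1 (Nat.le_zero.1 hr)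
    have hmem := mem_visited N i le_rfl h1
    rw [hbot, Submodule.mem_bot] at hmem
    have := h.norm_normal 1
    simp [hmem] at this
  | succ r ih =>
    intro κ hκ
    -- one constant serves for all spans of normals and all further normals, by finiteness
    obtain ⟨B, hB⟩ : ∃ B : ℝ, ∀ p : Set ι × ι, 1 + ‖N p.2 -
        (Submodule.span ℝ (N '' p.1)).starProjection (N p.2)‖⁻¹ ≤ B := by
      obtain ⟨B, hB⟩ := (Set.finite_range fun p : Set ι × ι => 1 + ‖N p.2 -
        (Submodule.span ℝ (N '' p.1)).starProjection (N p.2)‖⁻¹).bddAbove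
      exact ⟨B, fun p => hB ⟨p, rfl⟩⟩
    have hB' : ∀ p : Set ι × ι, 1 + ‖N p.2 -
        (Submodule.span ℝ (N '' p.1)).starProjection (N p.2)‖⁻¹ ≤ max B 1 :=
      fun p => (hB p).trans (le_max_left _ _)
    set b := max B 1 with hb
    have hb1 : 1 ≤ b := le_max_right _ _
    have hb0 : 0 < b := by linarith
    obtain ⟨δ₁, hδ₁, hih⟩ := ih (κ / (4 * b)) (by positivity)
    have hl1 : 0 < 1 - l := by linarith
    refine ⟨min (min δ₁ 1) (min (κ / (8 * b)) (κ ^ 2 * (1 - l) / 40)), by positivity, ?_⟩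
    intro δ hδ hδ₀ i v u g c h h0 T hT m hm1 hmT hr
    have d1 : δ ≤ δ₁ := hδ₀.trans ((min_le_left _ _).trans (min_le_left _ _))
    have d2 : δ ≤ 1 := hδ₀.trans ((min_le_left _ _).trans (min_le_right _ _))
    have d3 : δ ≤ κ / (8 * b) := hδ₀.trans ((min_le_right _ _).trans (min_le_left _ _))
    have d4 : δ ≤ κ ^ 2 * (1 - l) / 40 := hδ₀.trans ((min_le_right _ _).trans (min_le_right _ _))
    -- `p` is the first time at which the span of the visited normals is that at time `m`
    have hex : ∃ p, 1 ≤ p ∧ visited N i p = visited N i m := ⟨m, hm1, rfl⟩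
    classical
    obtain ⟨hp1, hpW⟩ := Nat.find_spec hex
    have hpmin := fun q => Nat.find_min (m := q) hex
    have hpm : Nat.find hex ≤ m := Nat.find_min' hex ⟨hm1, rfl⟩
    set p := Nat.find hex with hp
    set W := visited N i m with hW
    have hstart : ‖W.starProjection (u p)‖ ≤ κ / 2 := by
      obtain ⟨q, hq⟩ := Nat.exists_eq_add_of_le' hp1
      rcases Nat.eq_zero_or_pos q with rfl | hq0
      · have h1 : visited N i 1 = visited N i 0 ⊔ Submodule.span ℝ {N (i 1)} := visited_succ N i 0
        have h2 : visited N i 0 = ⊥ := by simp [visited]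
        have h3 := h.inner_eq_zero 1
        rw [h2, bot_sup_eq, ← zero_add 1, ← hq, hpW] at h1
        rw [h1, hq, zero_add, Submodule.starProjection_unit_singleton ℝ (h.norm_normal 1), h3]
        simp only [zero_smul, norm_zero]
        positivity
      · have hlt : visited N i q < W := by
          refine lt_of_le_of_ne (visited_mono N i (by omega)) fun heq => ?_
          exact hpmin q (by omega) ⟨hq0, heq⟩
        have hfin : Module.finrank ℝ (visited N i q) ≤ r := by
          have := Submodule.finrank_lt_finrank_of_lt hlt
          omega
        have h1 := hih δ hδ d1 i v u g c h h0 T hT q hq0 (by omega) hfin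
        have h2 : ‖(visited N i q).starProjection (u (q + 1))‖ ≤ κ / (4 * b) + 2 * δ := by
          rw [h.step, map_add, map_smul]
          refine (norm_add_le _ _).trans (add_le_add h1 ?_)
          have h3 := h.abs_step_le hl hδ h0 hT hq0 (by omega)
          have h4 := (visited N i q).norm_starProjection_apply_le (v q)
          rw [h.norm_velocity] at h4
          rw [norm_smul, Real.norm_eq_abs]
          calc |c q| * ‖(visited N i q).starProjection (v q)‖ ≤ (2 * δ) * 1 := by gcongr
            _ = 2 * δ := mul_one _
        have h3 := norm_starProjection_sup_le (W := visited N i q) (U := W)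
          (by rw [← visited_succ, ← hq, hpW]) (h.norm_normal (q + 1)) (h.inner_eq_zero (q + 1))
        rw [hq]
        have h4 := hB' (i '' Set.Icc 1 q, i (q + 1))
        calc _ ≤ _ := h3
          _ ≤ b * (κ / (4 * b) + 2 * δ) := by gcongr; exact h4
          _ ≤ b * (κ / (4 * b) + 2 * (κ / (8 * b))) := by gcongr
          _ = κ / 2 := by field_simp; ring
    obtain ⟨s, hs⟩ := Nat.exists_eq_add_of_le hpm
    have hdrift := h.norm_starProjection_drift_le hl (W := W) (m := p) (i := s) (B := 2 * δ)
      (fun k h1 h2 => mem_visited N i (by omega) (by omega))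
      (fun k h1 h2 => h.abs_step_le hl hδ h0 hT (by omega) (by omega)) (by positivity)
    rw [← hs] at hdrift
    have e1 := Submodule.norm_sq_eq_add_norm_sq_starProjection (u m) W
    have e2 := Submodule.norm_sq_eq_add_norm_sq_starProjection (u p) W
    have e3 := h.norm_sq_le hl hδ h0 hT hm1 hmT
    have e4 := h.one_le_norm_sq hl h0 p
    have e5 := h.norm_sq_le hl hδ h0 hT hp1 (hpm.trans hmT)
    set x := ‖Wᗮ.starProjection (u m)‖ with hx
    set y := ‖Wᗮ.starProjection (u p)‖ with hy
    set D := 2 * δ / (1 - l) with hD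
    have hy0 : 0 ≤ y := norm_nonneg _
    have hxy : y ≤ x + D := by
      have := norm_le_norm_add_norm_sub (Wᗮ.starProjection (u m)) (Wᗮ.starProjection (u p))
      rw [← hx, ← hy] at this
      linarith
    have hδD : 2 * δ ≤ D := by
      rw [hD, le_div_iff₀ hl1]; nlinarith
    have hDκ : D ≤ κ ^ 2 / 20 := by
      rw [hD, div_le_iff₀ hl1]; linarith
    have hstart2 : ‖W.starProjection (u p)‖ ^ 2 ≤ (κ / 2) ^ 2 :=
      pow_le_pow_left₀ (norm_nonneg _) hstart 2
    exact le_of_sq_le_sq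
      (sq_le_of_drift e1 e2 e3 e4 e5 hy0 hxy hδ.le d2 hδD hDκ hstart2) hκ.le

/-- Uniform growth of the transverse component: it increases by a definite factor during every time
window in which the visited normals span the space. The factor depends only on the finite set of
normals and on the contraction rate, not on the length of the window. -/
theorem exists_growth [FiniteDimensional ℝ V] {ι : Type*} [Finite ι] (N : ι → V) {l : ℝ}
    (hl0 : 0 ≤ l) (hl : l < 1) :
    ∃ σ : ℝ, 1 < σ ∧ ∀ (i : ℕ → ι) (v u : ℕ → V) (g c : ℕ → ℝ),
      IsTransport l (fun k => N (i k)) v u g c → ∀ T : ℕ, 1 ≤ T → visited N i T = ⊤ →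
        σ * transverse (u 0) (v 0) ≤ transverse (u T) (v T) := by
  obtain ⟨δ, hδ, H⟩ := exists_tolerance N hl0 hl (Module.finrank ℝ V) (1 / 2) (by norm_num)
  have hl2 : 0 < 1 - l ^ 2 := by nlinarith
  refine ⟨1 + (1 - l ^ 2) * δ ^ 2, by nlinarith [mul_pos hl2 (pow_pos hδ 2)], ?_⟩
  intro i v u g c h T hT htop
  rcases (transverse_nonneg (u := u 0) (h.norm_velocity 0)).eq_or_lt with hz | hpos
  · rw [← hz, mul_zero]; exact transverse_nonneg (h.norm_velocity T)
  by_contra hcon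
  rw [not_le] at hcon
  -- the displacements are rescaled so that the transverse component has length `1` at time `0`
  set a := (√(transverse (u 0) (v 0)))⁻¹ with ha
  have ha2 : a ^ 2 * transverse (u 0) (v 0) = 1 := by
    rw [ha, inv_pow, Real.sq_sqrt hpos.le, inv_mul_cancel₀ hpos.ne']
  have ha0 : 0 < a ^ 2 := by
    have : 0 < a := inv_pos.2 (Real.sqrt_pos.2 hpos)
    positivity
  have h' : IsTransport l (fun k => N (i k)) v (fun k => a • u k) g (fun k => a * c k) :=
    { norm_normal := h.norm_normal
      norm_velocity := h.norm_velocity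
      inner_eq_zero := fun k => by rw [inner_smul_right, h.inner_eq_zero, mul_zero]
      step := fun k => by rw [h.step, smul_add, smul_smul]
      abs_factor_le := h.abs_factor_le
      collision := h.collision }
  have h0 : transverse (a • u 0) (v 0) = 1 := by rw [transverse_smul, ha2]
  have hT' : transverse (a • u T) (v T) ≤ 1 + (1 - l ^ 2) * δ ^ 2 := by
    rw [transverse_smul]
    have := mul_le_mul_of_nonneg_left hcon.le ha0.le
    rw [mul_left_comm, ha2, mul_one] at this
    exact this
  have h1 := H δ hδ le_rfl i v _ g _ h' h0 T hT' T hT le_rfl (Submodule.finrank_le _)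
  have h2 := h'.one_le_norm_sq hl h0 T
  simp only [htop, Submodule.starProjection_top, ContinuousLinearMap.id_apply] at h1
  nlinarith [norm_nonneg (a • u T)]

end Transport

/-! ### Expansion along orbits -/

lemma oblique_self {v n : E d} (h : ⟪n, v⟫ ≠ 0) : oblique v n v = 0 := by
  rw [oblique_apply, inv_mul_cancel₀ h, one_smul, sub_self]

lemma oblique_of_inner_eq_zero {v n z : E d} (hz : ⟪n, z⟫ = 0) : oblique v n z = z := by
  rw [oblique_apply, hz, mul_zero, zero_smul, sub_zero]

lemma exists_oblique_eq (v n z : E d) : ∃ c : ℝ, oblique v n z = z + c • v :=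
  ⟨-(⟪n, v⟫⁻¹ * ⟪n, z⟫), by rw [oblique_apply, neg_smul, sub_eq_add_neg]⟩

/-- Two projections along the same direction: the second one forgets the first. -/
lemma oblique_oblique {v n m : E d} (h : ⟪n, v⟫ ≠ 0) (z : E d) :
    oblique v n (oblique v m z) = oblique v n z := by
  obtain ⟨c, hc⟩ := exists_oblique_eq v m z
  rw [hc, map_add, map_smul, oblique_self h, smul_zero, add_zero]

lemma transverse_oblique {v : E d} (hv : ‖v‖ = 1) (n z : E d) :
    transverse (oblique v n z) v = transverse z v := by
  obtain ⟨c, hc⟩ := exists_oblique_eq v n z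
  rw [hc, transverse_add_smul hv]

/-- On a face that the velocity does not graze, the transverse component controls the norm. -/
lemma mul_norm_sq_le_transverse {n v u : E d} {κ : ℝ} (hn : ‖n‖ = 1) (hv : ‖v‖ = 1)
    (hκ : 0 ≤ κ) (hnv : κ ≤ ⟪v, n⟫) (hu : ⟪n, u⟫ = 0) : κ ^ 2 * ‖u‖ ^ 2 ≤ transverse u v := by
  have h1 : ⟪u, v⟫ = ⟪u, perp n v⟫ := (inner_perp_of_inner_eq_zero hu).symm
  have h2 := norm_perp_sq hn v
  rw [hv, real_inner_comm] at h2
  have h3 := pow_le_pow_left₀ (abs_nonneg _) (abs_real_inner_le_norm u (perp n v)) 2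
  rw [sq_abs, mul_pow, h2] at h3
  have h4 := pow_le_pow_left₀ hκ hnv 2
  unfold transverse
  rw [h1]
  nlinarith [sq_nonneg ‖u‖]

lemma eq_perp_add {n : E d} (z : E d) : z = perp n z + ⟪n, z⟫ • n := by
  rw [perp_apply]; abel

namespace Polytope
variable {P : Polytope d}

/-- A collision changes the velocity, up to a multiple of the normal, by a factor of absolute value
at most `contractionRate f`. -/
lemma Hits.exists_collision {i j : Fin P.N} {x : X d} (h : P.Hits i j x)
    (hf : IsContractingReflectionLaw f) : ∃ g r : ℝ, |g| ≤ contractionRate f ∧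
      (P.billiardMap f x).snd = g • x.snd + r • P.normal j := by
  have hn := P.norm_normal j
  have h1 : (P.billiardMap f x).snd =
      contract f (P.normal j) (reflect (P.normal j) x.snd) := by
    rw [h.billiardMap_eq]; rfl
  have h2 := perp_contract f hn h.reflect_mem
  rw [← h1, perp_reflect hn] at h2
  set g := profileSlope f ‖perp (P.normal j) x.snd‖ with hg
  refine ⟨g, ⟪P.normal j, (P.billiardMap f x).snd⟫ - g * ⟪P.normal j, x.snd⟫, ?_, ?_⟩
  · rw [hg, ← perp_reflect hn]
    exact abs_profileSlope_le hf (norm_mem_Ico (perp_mem_ball hn h.reflect_mem))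
  · conv_lhs => rw [eq_perp_add (n := P.normal j) (P.billiardMap f x).snd, h2, perp_apply]
    module

lemma exists_normalAt_eq {x : X d} (hx : x ∈ P.M) : ∃ i, P.normalAt x.fst = P.normal i := by
  obtain ⟨i, hi, _⟩ := hx
  exact ⟨i, normalAt_eq hi⟩

lemma norm_snd {x : X d} (hx : x ∈ P.M) : ‖x.snd‖ = 1 := by
  obtain ⟨i, _, h⟩ := hx
  exact h.1

lemma orbitDeriv_succ (n : ℕ) (x y : X d) : P.orbitDeriv f (n + 1) x y =
    P.mapDeriv f ((P.billiardMap f)^[n] x) (P.orbitDeriv f n x y) := rfl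

lemma orbitDeriv_mem_tangent (hf : IsContractingReflectionLaw f) {x y : X d}
    (hx : x ∈ P.MPlus f) (hy : y ∈ P.tangent x) (n : ℕ) :
    P.orbitDeriv f n x y ∈ P.tangent ((P.billiardMap f)^[n] x) := by
  cases n with
  | zero => exact hy
  | succ n =>
    rw [Function.iterate_succ_apply']
    exact mapDeriv_mem_tangent hf (hx.2 n)

lemma orbitDeriv_snd_eq_zero {x y : X d} (hy : y.snd = 0) (n : ℕ) :
    (P.orbitDeriv f n x y).snd = 0 := by
  induction n with
  | zero => exact hy
  | succ n ih => rw [orbitDeriv_succ, mapDeriv_snd, ih, map_zero]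

lemma exists_isTransport (hf : IsContractingReflectionLaw f) {x y : X d} (hx : x ∈ P.MPlus f)
    (hy : y ∈ P.tangent x) (hy0 : y.snd = 0) :
    ∃ (i : ℕ → Fin P.N) (g c : ℕ → ℝ),
      (∀ k, P.normalAt ((P.billiardMap f)^[k] x).fst = P.normal (i k)) ∧
      IsTransport (contractionRate f) (fun k => P.normal (i k))
        (fun k => ((P.billiardMap f)^[k] x).snd) (fun k => (P.orbitDeriv f k x y).fst) g c := by
  choose i hi using fun k => exists_normalAt_eq (hx.2 k).1
  have hcol : ∀ k, ∃ g r : ℝ, |g| ≤ contractionRate f ∧ ((P.billiardMap f)^[k + 1] x).snd =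
      g • ((P.billiardMap f)^[k] x).snd + r • P.normal (i (k + 1)) := by
    intro k
    obtain ⟨a, b, h⟩ := P.exists_hits (hx.2 k)
    have h1 : P.normalAt ((P.billiardMap f)^[k + 1] x).fst = P.normal b := by
      rw [Function.iterate_succ_apply']; exact h.normalAt_nextPoint
    rw [← hi, h1, Function.iterate_succ_apply']
    exact h.exists_collision hf
  choose g r hg hr using hcol
  have hstep : ∀ k, ∃ c : ℝ, (P.orbitDeriv f (k + 1) x y).fst =
      (P.orbitDeriv f k x y).fst + c • ((P.billiardMap f)^[k] x).snd := by
    intro k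
    rw [orbitDeriv_succ, mapDeriv_fst, orbitDeriv_snd_eq_zero hy0, smul_zero, add_zero]
    exact exists_oblique_eq _ _ _
  choose c hc using hstep
  refine ⟨i, g, c, hi, fun k => P.norm_normal _, fun k => norm_snd (hx.2 k).1, fun k => ?_, hc, hg,
    fun k => ⟨r k, hr k⟩⟩
  rw [real_inner_comm, ← hi]
  exact (orbitDeriv_mem_tangent hf hx hy k).1

end Polytope

lemma IsTransport.shift {V : Type*} [NormedAddCommGroup V] [InnerProductSpace ℝ V]
    {l : ℝ} {n v u : ℕ → V} {g c : ℕ → ℝ} (h : IsTransport l n v u g c) (m : ℕ) :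
    IsTransport l (fun k => n (m + k)) (fun k => v (m + k)) (fun k => u (m + k))
      (fun k => g (m + k)) (fun k => c (m + k)) :=
  ⟨fun _ => h.norm_normal _, fun _ => h.norm_velocity _, fun _ => h.inner_eq_zero _,
    fun _ => h.step _, fun _ => h.abs_factor_le _, fun _ => h.collision _⟩

namespace Polytope
variable {P : Polytope d}

lemma exists_isGenerating {x : X d} {τ : ℕ} (h : P.escapingTime f x ≤ (τ : ℕ∞)) :
    ∃ k, k ≤ τ ∧ P.IsGenerating f k x := by
  by_contra hcon
  push Not at hcon
  have h1 : ((τ + 1 : ℕ) : ℕ∞) ≤ P.escapingTime f x := by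
    refine le_iInf₂ fun k hk => ?_
    by_contra hlt
    rw [not_le, Nat.cast_lt] at hlt
    exact hcon k (by omega) hk.2
  have h2 := h1.trans h
  rw [Nat.cast_le] at h2
  omega

/-- The expansion of the position part of the derivative: the rate per escaping time depends only
on the polytope and on the reflection law. -/
lemma exists_expansion (P : Polytope d) (hf : IsContractingReflectionLaw f) :
    ∃ σ : ℝ, 1 < σ ∧ ∀ x ∈ P.MPlus f, ∀ τ : ℕ, 1 ≤ τ → P.escapingTime f x ≤ (τ : ℕ∞) →
      ∀ y ∈ P.tangent x, y.snd = 0 → ∀ n : ℕ,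
        σ ^ (n / τ) * transverse y.fst x.snd ≤ ‖(P.orbitDeriv f n x y).fst‖ ^ 2 := by
  obtain ⟨σ, hσ, H⟩ := exists_growth P.normal hf.contractionRate_pos.le hf.contractionRate_lt_one
  refine ⟨σ, hσ, fun x hx τ hτ hesc y hy hy0 n => ?_⟩
  obtain ⟨k, hk, hgen⟩ := exists_isGenerating hesc
  obtain ⟨i, g, c, hi, htr⟩ := exists_isTransport hf hx hy hy0
  set q : ℕ → ℝ := fun m => transverse (P.orbitDeriv f m x y).fst ((P.billiardMap f)^[m] x).snd
    with hq
  have hwin : ∀ m, σ * q m ≤ q (m + τ) := by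
    intro m
    refine H (fun a => i (m + a)) _ _ _ _ (htr.shift m) τ hτ ?_
    rw [eq_top_iff, ← hgen (m + 1), visited]
    refine Submodule.span_mono ?_
    rintro _ ⟨a, ha, rfl⟩
    refine ⟨i (m + (a + 1)), ⟨a + 1, ⟨by omega, by omega⟩, rfl⟩, ?_⟩
    rw [← hi, add_assoc m 1 a, add_comm 1 a]
  have hmul : ∀ a, σ ^ a * q 0 ≤ q (τ * a) := by
    intro a
    induction a with
    | zero => simp
    | succ a ih =>
      calc σ ^ (a + 1) * q 0 = σ * (σ ^ a * q 0) := by ring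
        _ ≤ σ * q (τ * a) := by gcongr
        _ ≤ q (τ * a + τ) := hwin _
        _ = q (τ * (a + 1)) := by rw [mul_add_one]
  calc σ ^ (n / τ) * transverse y.fst x.snd ≤ q (τ * (n / τ)) := hmul _
    _ ≤ q n := htr.transverse_monotone hf.contractionRate_lt_one (Nat.mul_div_le n τ)
    _ ≤ _ := transverse_le _ _

end Polytope

/-! ### The stable graph -/

/-- Orthogonal projections are controlled by arbitrary idempotents with the same ranges. -/
lemma norm_starProjection_sub_le {H : Type*} [NormedAddCommGroup H] [InnerProductSpace ℝ H]
    [FiniteDimensional ℝ H] {U W : Submodule ℝ H} {S T : H →L[ℝ] H}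
    (hS : ∀ y, S y ∈ U) (hS' : ∀ y ∈ U, S y = y) (hT : ∀ y, T y ∈ W) (hT' : ∀ y ∈ W, T y = y) :
    ‖U.starProjection - W.starProjection‖ ≤ 2 * ‖S - T‖ := by
  -- a vector of `U` is moved by at most `‖S - T‖` when it is projected to `W`
  have key : ∀ {U W : Submodule ℝ H} {S T : H →L[ℝ] H}, (∀ y ∈ U, S y = y) → (∀ y, T y ∈ W) →
      ∀ y ∈ U, ‖y - W.starProjection y‖ ≤ ‖S - T‖ * ‖y‖ := by
    intro U W S T hS' hT y hy
    have h1 : y - W.starProjection y = Wᗮ.starProjection ((S - T) y) := by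
      rw [sub_apply, hS' y hy, map_sub,
        Submodule.starProjection_orthogonal_apply_eq_zero (hT y), sub_zero,
        Submodule.starProjection_orthogonal_val]
    rw [h1]
    exact (Submodule.norm_starProjection_apply_le _ _).trans ((S - T).le_opNorm y)
  refine ContinuousLinearMap.opNorm_le_bound _ (by positivity) fun z => ?_
  set a := z - U.starProjection z with ha
  have hsplit : (U.starProjection - W.starProjection) z =
      (U.starProjection z - W.starProjection (U.starProjection z)) - W.starProjection a := by
    rw [ha, map_sub, sub_apply]; abel
  have h1 : ‖U.starProjection z - W.starProjection (U.starProjection z)‖ ≤ ‖S - T‖ * ‖z‖ :=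
    (key hS' hT _ (U.starProjection_apply_mem z)).trans
      (by gcongr; exact U.norm_starProjection_apply_le z)
  -- the vector `a` is orthogonal to `U`; its projection to `W` is estimated by duality
  have h2 : ‖W.starProjection a‖ ≤ ‖S - T‖ * ‖z‖ := by
    set b := W.starProjection a with hb
    have hbW : b ∈ W := W.starProjection_apply_mem a
    have h3 := key hT' hS b hbW
    have h4 : ‖b‖ ^ 2 = ⟪b - U.starProjection b, a⟫ := by
      have e1 : ⟪a - b, b⟫ = 0 := W.starProjection_inner_eq_zero a b hbW
      have e2 : ⟪a, U.starProjection b⟫ = 0 :=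
        U.starProjection_inner_eq_zero z _ (U.starProjection_apply_mem b)
      rw [inner_sub_left, sub_eq_zero] at e1
      rw [inner_sub_left, real_inner_comm a (U.starProjection b), e2, sub_zero,
        ← real_inner_self_eq_norm_sq, ← e1, real_inner_comm]
    have h5 : ‖a‖ ≤ ‖z‖ := by
      rw [ha, ← Submodule.starProjection_orthogonal_val]
      exact Submodule.norm_starProjection_apply_le _ _
    have h6 : ‖b‖ * ‖b‖ ≤ ‖b‖ * (‖S - T‖ * ‖z‖) := by
      rw [← sq, h4]
      calc _ ≤ ‖b - U.starProjection b‖ * ‖a‖ := real_inner_le_norm _ _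
        _ ≤ (‖T - S‖ * ‖b‖) * ‖z‖ := by gcongr
        _ = ‖b‖ * (‖S - T‖ * ‖z‖) := by rw [norm_sub_rev]; ring
    rcases (norm_nonneg b).eq_or_lt with h0 | h0
    · rw [← h0]; positivity
    · exact le_of_mul_le_mul_left h6 h0
  rw [hsplit]
  calc _ ≤ _ := norm_sub_le _ _
    _ ≤ 2 * ‖S - T‖ * ‖z‖ := by linarith

lemma continuousOn_starProjection {α H : Type*} [TopologicalSpace α] [NormedAddCommGroup H]
    [InnerProductSpace ℝ H] [FiniteDimensional ℝ H] {U : α → Submodule ℝ H} {T : α → H →L[ℝ] H}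
    {s : Set α} (hc : ContinuousOn T s) (hT : ∀ x ∈ s, ∀ y, T x y ∈ U x)
    (hT' : ∀ x ∈ s, ∀ y ∈ U x, T x y = y) : ContinuousOn (fun x => (U x).starProjection) s := by
  intro x hx
  have h := tendsto_iff_norm_sub_tendsto_zero.1 (hc x hx)
  rw [ContinuousWithinAt, tendsto_iff_norm_sub_tendsto_zero]
  refine squeeze_zero' (Filter.Eventually.of_forall fun _ => norm_nonneg _) ?_
    (by simpa using h.const_mul 2)
  filter_upwards [self_mem_nhdsWithin] with y hy
  exact norm_starProjection_sub_le (hT y hy) (hT' y hy) (hT x hx) (hT' x hx)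

lemma continuous_perp : Continuous (perp : E d → E d →L[ℝ] E d) := by
  have hL : Continuous (fun v : E d => (innerSL ℝ v).smulRight v) :=
    ((ContinuousLinearMap.smulRightL ℝ (E d) (E d)).continuous.comp
      (innerSL ℝ (E := E d)).continuous).clm_apply continuous_id
  exact continuous_const.sub hL

/-- A uniform lower bound for the cosine of the angle between a velocity after a collision and the
normal. -/
def minCos (f : ℝ → ℝ) : ℝ := Real.cos (lawRate f * (Real.pi / 2))

namespace Polytope
variable {P : Polytope d}

lemma Hits.minCos_le {i j : Fin P.N} {x : X d} (h : P.Hits i j x)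
    (hf : IsContractingReflectionLaw f) :
    minCos f ≤ ⟪(P.billiardMap f x).snd, P.normalAt (P.billiardMap f x).fst⟫ := by
  have h1 : P.normalAt (P.billiardMap f x).fst = P.normal j := h.normalAt_nextPoint
  have h2 : (P.billiardMap f x).snd =
      contract f (P.normal j) (reflect (P.normal j) x.snd) := by
    rw [h.billiardMap_eq]; rfl
  rw [h1, h2, inner_contract f (P.norm_normal j) h.reflect_mem]
  exact hf.cos_lawRate_le (arccos_mem_angleDomain (P.norm_normal j) h.reflect_mem)

section Invariant
variable {Λ : Set (X d)} (hΛ : P.IsInvariant f Λ)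
include hΛ

lemma IsInvariant.mem_MPlus {x : X d} (hx : x ∈ Λ) : x ∈ P.MPlus f := by
  have := Set.mem_iInter.1 (hΛ.1 hx) 0
  simpa using this

lemma IsInvariant.mem_M' {x : X d} (hx : x ∈ Λ) : x ∈ P.M' := by
  rw [← hΛ.2] at hx; exact hx.1

lemma IsInvariant.map_mem {x : X d} (hx : x ∈ Λ) : P.billiardMap f x ∈ Λ := by
  rw [← hΛ.2] at hx; exact hx.2

lemma IsInvariant.iterate_mem {x : X d} (hx : x ∈ Λ) (n : ℕ) : (P.billiardMap f)^[n] x ∈ Λ := by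
  induction n with
  | zero => exact hx
  | succ n ih => rw [Function.iterate_succ_apply']; exact IsInvariant.map_mem hΛ ih

lemma IsInvariant.minCos_le (hf : IsContractingReflectionLaw f) {x : X d} (hx : x ∈ Λ) :
    minCos f ≤ ⟪x.snd, P.normalAt x.fst⟫ := by
  obtain ⟨y, hy, hyx⟩ := Set.mem_iInter.1 (hΛ.1 hx) 1
  simp only [Function.iterate_one] at hyx
  obtain ⟨i, j, h⟩ := P.exists_hits (hy.2 0)
  rw [← hyx]
  exact h.minCos_le hf

end Invariant

variable (P f) in
/-- The velocity part of the derivative of the billiard map, extended to the ambient space by the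
orthogonal projection onto the hyperplane orthogonal to the velocity. -/
def velContraction (x : X d) : E d →L[ℝ] E d := P.velDeriv f x ∘L perp x.snd

lemma velContraction_eq {x : X d} {w : E d} (hw : ⟪x.snd, w⟫ = 0) :
    P.velContraction f x w = P.velDeriv f x w := by
  rw [velContraction, ContinuousLinearMap.comp_apply, perp_of_inner_eq_zero hw]

lemma norm_velContraction_le (hf : IsContractingReflectionLaw f) {x : X d} (hx : x ∈ P.M')
    (w : E d) : ‖P.velContraction f x w‖ ≤ contractionRate f * ‖w‖ := by
  obtain ⟨i, j, h⟩ := P.exists_hits hx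
  have hv := norm_snd hx.1
  rw [velContraction, velDeriv, h.normalAt_nextPoint, ContinuousLinearMap.comp_apply,
    ContinuousLinearMap.comp_apply, reflectL_apply]
  have h1 := norm_contractDeriv_le hf (P.norm_normal j) h.reflect_mem
    (h := reflect (P.normal j) (perp x.snd w))
    (by rw [inner_reflect_reflect (P.norm_normal j), inner_perp_self hv])
  rw [norm_reflect (P.norm_normal j)] at h1
  have := norm_perp_le hv w
  have := hf.contractionRate_pos
  exact h1.trans (by gcongr)

lemma inner_velContraction (hf : IsContractingReflectionLaw f) {x : X d} (hx : x ∈ P.M')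
    (w : E d) : ⟪(P.billiardMap f x).snd, P.velContraction f x w⟫ = 0 := by
  have h := (mapDeriv_mem_tangent hf (y := WithLp.toLp 2 (0, perp x.snd w)) hx).2
  rw [real_inner_comm]
  exact h

lemma inner_normalAt_pos {x : X d} (hx : x ∈ P.M) : 0 < ⟪P.normalAt x.fst, x.snd⟫ := by
  obtain ⟨i, hi, h⟩ := hx
  rw [normalAt_eq hi, real_inner_comm]
  exact h.2

lemma inner_backProj {x : X d} (hx : x ∈ P.M) (z : E d) :
    ⟪P.normalAt x.fst, P.backProj x z⟫ = 0 :=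
  inner_oblique (inner_normalAt_pos hx).ne' z

variable (P f) in
/-- The terms of the series for the stable graph. If a base point and a velocity differ
infinitesimally by `S w` and `w`, the displacement caused by the deviating velocity on the `n`-th
flight has to be compensated; `stableTerm n x w` is that displacement, pulled back to `x`. -/
def stableTerm : ℕ → X d → E d →L[ℝ] E d
  | 0, x => P.flightTime x • P.backProj x
  | n + 1, x => P.backProj x ∘L stableTerm n (P.billiardMap f x) ∘L P.velContraction f x

lemma stableTerm_zero_apply (x : X d) (w : E d) :
    P.stableTerm f 0 x w = P.flightTime x • P.backProj x w := rfl

lemma stableTerm_succ_apply (n : ℕ) (x : X d) (w : E d) : P.stableTerm f (n + 1) x w =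
    P.backProj x (P.stableTerm f n (P.billiardMap f x) (P.velContraction f x w)) := rfl

lemma inner_stableTerm {x : X d} (hx : x ∈ P.M) (n : ℕ) (w : E d) :
    ⟪P.normalAt x.fst, P.stableTerm f n x w⟫ = 0 := by
  cases n with
  | zero => rw [stableTerm_zero_apply, inner_smul_right, inner_backProj hx, mul_zero]
  | succ n => exact inner_backProj hx _

/-- The transverse component of a displacement along a face does not decrease at a collision. -/
lemma transverse_le_transverse (hf : IsContractingReflectionLaw f) {x : X d} (hx : x ∈ P.M')
    {z : E d} (hz : ⟪P.normalAt (P.billiardMap f x).fst, z⟫ = 0) :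
    transverse z x.snd ≤ transverse z (P.billiardMap f x).snd := by
  obtain ⟨i, j, h⟩ := P.exists_hits hx
  have h1 : P.normalAt (P.billiardMap f x).fst = P.normal j := h.normalAt_nextPoint
  rw [h1] at hz
  obtain ⟨g, r, hg, hr⟩ := h.exists_collision hf
  have hg1 : g ^ 2 ≤ 1 := by
    rw [← sq_abs]
    exact pow_le_one₀ (abs_nonneg g) (hg.trans hf.contractionRate_lt_one.le)
  unfold transverse
  rw [hr, inner_add_right, inner_smul_right, inner_smul_right, real_inner_comm (P.normal j), hz]
  nlinarith [sq_nonneg ⟪z, x.snd⟫]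

lemma exists_flightTime_le (P : Polytope d) :
    ∃ R : ℝ, 0 < R ∧ ∀ x ∈ P.M', 0 < P.flightTime x ∧ P.flightTime x ≤ R := by
  obtain ⟨R, hR0, hR⟩ := P.isCompact.isBounded.exists_pos_norm_le
  refine ⟨2 * R, by positivity, fun x hx => ?_⟩
  obtain ⟨i, j, h⟩ := P.exists_hits hx
  rw [h.flightTime_eq]
  refine ⟨h.hitTime_pos, ?_⟩
  have h1 := hR _ h.start_mem.1.1
  have h2 := hR _ h.end_mem.1.1
  have h3 : ‖P.hitTime j x • x.snd‖ ≤ ‖x.fst + P.hitTime j x • x.snd‖ + ‖x.fst‖ := by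
    have := norm_sub_le (x.fst + P.hitTime j x • x.snd) x.fst
    rwa [add_sub_cancel_left] at this
  rw [norm_smul, norm_snd hx.1, mul_one, Real.norm_eq_abs, abs_of_pos h.hitTime_pos] at h3
  linarith

lemma transverse_stableTerm_le (hf : IsContractingReflectionLaw f) {R : ℝ}
    (hR : ∀ x ∈ P.M', 0 < P.flightTime x ∧ P.flightTime x ≤ R) {x : X d} (hx : x ∈ P.MPlus f)
    (n : ℕ) (w : E d) :
    transverse (P.stableTerm f n x w) x.snd ≤ (R * contractionRate f ^ n * ‖w‖) ^ 2 := by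
  have hl := hf.contractionRate_pos
  induction n generalizing x w with
  | zero =>
    have hx0 := hx.2 0
    obtain ⟨h1, h2⟩ := hR x hx0
    rw [stableTerm_zero_apply, transverse_smul, backProj, transverse_oblique (norm_snd hx.1),
      pow_zero, mul_one, mul_pow]
    have := transverse_le w x.snd
    have := transverse_nonneg (u := w) (norm_snd hx.1)
    gcongr
  | succ n ih =>
    have hx0 : x ∈ P.M' := hx.2 0
    have hx' : P.billiardMap f x ∈ P.MPlus f :=
      ⟨(hx.2 1).1, fun n => by rw [← Function.iterate_succ_apply]; exact hx.2 (n + 1)⟩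
    have hR0 : 0 < R := (hR x hx0).1.trans_le (hR x hx0).2
    rw [stableTerm_succ_apply, backProj, transverse_oblique (norm_snd hx.1)]
    refine (transverse_le_transverse hf hx0 (inner_stableTerm hx'.1 n _)).trans ((ih hx' _).trans ?_)
    have := norm_velContraction_le hf hx0 w
    calc (R * contractionRate f ^ n * ‖P.velContraction f x w‖) ^ 2
        ≤ (R * contractionRate f ^ n * (contractionRate f * ‖w‖)) ^ 2 := by gcongr
      _ = _ := by ring

section Invariant
variable {Λ : Set (X d)}

lemma norm_stableTerm_le (hΛ : P.IsInvariant f Λ) (hf : IsContractingReflectionLaw f) {R : ℝ}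
    (hR0 : 0 < R) (hR : ∀ x ∈ P.M', 0 < P.flightTime x ∧ P.flightTime x ≤ R) {x : X d}
    (hx : x ∈ Λ) (n : ℕ) :
    ‖P.stableTerm f n x‖ ≤ R / minCos f * contractionRate f ^ n := by
  have hl := hf.contractionRate_pos
  have hκ : 0 < minCos f := hf.cos_lawRate_pos
  have hxM := IsInvariant.mem_MPlus hΛ hx
  obtain ⟨i, hi⟩ := exists_normalAt_eq hxM.1
  refine ContinuousLinearMap.opNorm_le_bound _ (by positivity) fun w => ?_
  have h1 := transverse_stableTerm_le hf hR hxM n w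
  have h2 := mul_norm_sq_le_transverse (by rw [hi, P.norm_normal]) (norm_snd hxM.1) hκ.le
    (IsInvariant.minCos_le hΛ hf hx) (inner_stableTerm (f := f) hxM.1 n w)
  rw [← mul_pow] at h2
  have h3 := le_of_sq_le_sq (h2.trans h1) (by positivity)
  rw [div_mul_eq_mul_div, div_mul_eq_mul_div, le_div_iff₀ hκ, mul_comm]
  exact h3

lemma continuousOn_stableTerm (hΛ : P.IsInvariant f Λ) (hf : IsContractingReflectionLaw f)
    (n : ℕ) : ContinuousOn (P.stableTerm f n) Λ := by
  have hsub : Λ ⊆ P.M := fun x hx => (IsInvariant.mem_M' hΛ hx).1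
  have hQ : ContinuousOn P.backProj Λ := fun x hx =>
    (continuousWithinAt_backProj (IsInvariant.mem_M' hΛ hx)).mono hsub
  induction n with
  | zero =>
    have ht : ContinuousOn P.flightTime Λ := fun x hx =>
      (continuousWithinAt_flightTime (IsInvariant.mem_M' hΛ hx)).mono hsub
    exact ht.smul hQ
  | succ n ih =>
    have hΦ : ContinuousOn (P.billiardMap f) Λ := fun x hx =>
      (continuousWithinAt_billiardMap hf (IsInvariant.mem_M' hΛ hx)).mono hsub
    have hV : ContinuousOn (P.velDeriv f) Λ := fun x hx =>
      (continuousWithinAt_velDeriv hf (IsInvariant.mem_M' hΛ hx)).mono hsub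
    have hp : ContinuousOn (fun x : X d => perp x.snd) Λ :=
      (continuous_perp.comp continuous_velocity).continuousOn
    exact hQ.clm_comp ((ih.comp hΦ fun x hx => IsInvariant.map_mem hΛ hx).clm_comp
      (hV.clm_comp hp))

variable (P f) in
/-- The linear map whose graph is the stable subspace. -/
def stableGraph (x : X d) : E d →L[ℝ] E d := -∑' n, P.stableTerm f n x

lemma summable_stableTerm (hΛ : P.IsInvariant f Λ) (hf : IsContractingReflectionLaw f)
    {x : X d} (hx : x ∈ Λ) : Summable fun n => P.stableTerm f n x := by
  obtain ⟨R, hR0, hR⟩ := exists_flightTime_le P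
  exact Summable.of_norm_bounded ((summable_geometric_of_lt_one hf.contractionRate_pos.le
    hf.contractionRate_lt_one).mul_left _) (norm_stableTerm_le hΛ hf hR0 hR hx)

lemma continuousOn_stableGraph (hΛ : P.IsInvariant f Λ) (hf : IsContractingReflectionLaw f) :
    ContinuousOn (P.stableGraph f) Λ := by
  obtain ⟨R, hR0, hR⟩ := exists_flightTime_le P
  exact (continuousOn_tsum (continuousOn_stableTerm hΛ hf)
    ((summable_geometric_of_lt_one hf.contractionRate_pos.le
      hf.contractionRate_lt_one).mul_left _)
    fun n x hx => norm_stableTerm_le hΛ hf hR0 hR hx n).neg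

lemma norm_stableGraph_le (hΛ : P.IsInvariant f Λ) (hf : IsContractingReflectionLaw f) {R : ℝ}
    (hR0 : 0 < R) (hR : ∀ x ∈ P.M', 0 < P.flightTime x ∧ P.flightTime x ≤ R) {x : X d}
    (hx : x ∈ Λ) : ‖P.stableGraph f x‖ ≤ R / minCos f * (1 - contractionRate f)⁻¹ := by
  rw [stableGraph, norm_neg]
  exact tsum_of_norm_bounded ((hasSum_geometric_of_lt_one hf.contractionRate_pos.le
    hf.contractionRate_lt_one).mul_left _) (norm_stableTerm_le hΛ hf hR0 hR hx)

lemma hasSum_stableTerm_apply (hΛ : P.IsInvariant f Λ) (hf : IsContractingReflectionLaw f)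
    {x : X d} (hx : x ∈ Λ) (w : E d) :
    HasSum (fun n => P.stableTerm f n x w) (-P.stableGraph f x w) := by
  have h := (summable_stableTerm hΛ hf hx).hasSum.mapL (ContinuousLinearMap.apply ℝ (E d) w)
  simpa [stableGraph] using h

lemma inner_stableGraph (hΛ : P.IsInvariant f Λ) (hf : IsContractingReflectionLaw f)
    {x : X d} (hx : x ∈ Λ) (w : E d) : ⟪P.normalAt x.fst, P.stableGraph f x w⟫ = 0 := by
  have h := (hasSum_stableTerm_apply hΛ hf hx w).mapL (innerSL ℝ (P.normalAt x.fst))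
  simp only [innerSL_apply_apply, inner_stableTerm (IsInvariant.mem_M' hΛ hx).1] at h
  have := h.unique hasSum_zero
  rwa [inner_neg_right, neg_eq_zero] at this

/-- The invariance of the stable graph under the derivative of the billiard map. -/
lemma stableGraph_apply (hΛ : P.IsInvariant f Λ) (hf : IsContractingReflectionLaw f)
    {x : X d} (hx : x ∈ Λ) (w : E d) : P.stableGraph f x w =
      P.backProj x (P.stableGraph f (P.billiardMap f x) (P.velContraction f x w) -
        P.flightTime x • w) := by
  have h1 := (hasSum_stableTerm_apply hΛ hf (IsInvariant.map_mem hΛ hx)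
    (P.velContraction f x w)).mapL (P.backProj x)
  have h2 : HasSum (fun n => P.stableTerm f (n + 1) x w) _ := h1
  have h3 := ((hasSum_nat_add_iff (f := fun n => P.stableTerm f n x w) 1).1 h2).unique
    (hasSum_stableTerm_apply hΛ hf hx w)
  rw [Finset.sum_range_one, stableTerm_zero_apply, map_neg] at h3
  rw [map_sub, map_smul, ← neg_neg (P.stableGraph f x w), ← h3]
  abel

end Invariant
end Polytope

/-! ### The hyperbolic splitting -/

namespace Polytope
variable {P : Polytope d}

variable (P f) in
/-- The stable subspace at `x`: the graph of `stableGraph` over the velocities. -/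
def stableSpace (x : X d) : Submodule ℝ (X d) where
  carrier := {y | y ∈ P.tangent x ∧ y.fst = P.stableGraph f x y.snd}
  add_mem' := by
    rintro a b ⟨ha, ha'⟩ ⟨hb, hb'⟩
    exact ⟨add_mem ha hb, by rw [WithLp.add_fst, WithLp.add_snd, map_add, ha', hb']⟩
  zero_mem' := ⟨zero_mem _, by simp⟩
  smul_mem' := by
    rintro c a ⟨ha, ha'⟩
    exact ⟨Submodule.smul_mem _ c ha, by rw [WithLp.smul_fst, WithLp.smul_snd, map_smul, ha']⟩

variable (P) in
/-- The unstable subspace at `x`: the tangent vectors that leave the velocity fixed. -/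
def unstableSpace (x : X d) : Submodule ℝ (X d) where
  carrier := {y | y ∈ P.tangent x ∧ y.snd = 0}
  add_mem' := by
    rintro a b ⟨ha, ha'⟩ ⟨hb, hb'⟩
    exact ⟨add_mem ha hb, by rw [WithLp.add_snd, ha', hb', add_zero]⟩
  zero_mem' := ⟨zero_mem _, rfl⟩
  smul_mem' := by
    rintro c a ⟨ha, ha'⟩
    exact ⟨Submodule.smul_mem _ c ha, by rw [WithLp.smul_snd, ha', smul_zero]⟩

lemma mem_stableSpace_iff {x y : X d} : y ∈ P.stableSpace f x ↔
    y ∈ P.tangent x ∧ y.fst = P.stableGraph f x y.snd := Iff.rfl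

lemma phase_ext {a b : X d} (h1 : a.fst = b.fst) (h2 : a.snd = b.snd) : a = b :=
  (WithLp.equiv 2 (E d × E d)).injective (Prod.ext h1 h2)

lemma DPhi_one_apply (hf : IsContractingReflectionLaw f) {x y : X d} (hx : x ∈ P.MPlus f)
    (hy : y ∈ P.tangent x) : P.DPhi f 1 x y = P.mapDeriv f x y :=
  DPhi_apply hf hx 1 hy

section Invariant
variable {Λ : Set (X d)}

lemma disjoint_stableSpace_unstableSpace (x : X d) :
    Disjoint (P.stableSpace f x) (P.unstableSpace x) := by
  rw [Submodule.disjoint_def]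
  rintro y ⟨_, h1⟩ ⟨_, h2⟩
  refine phase_ext ?_ h2
  rw [h1, h2, map_zero]
  rfl

lemma stableSpace_sup_unstableSpace (hΛ : P.IsInvariant f Λ) (hf : IsContractingReflectionLaw f)
    {x : X d} (hx : x ∈ Λ) : P.stableSpace f x ⊔ P.unstableSpace x = P.tangent x := by
  refine le_antisymm (sup_le (fun y hy => hy.1) fun y hy => hy.1) fun y hy => ?_
  have hs := inner_stableGraph hΛ hf hx y.snd
  refine Submodule.mem_sup.2 ⟨WithLp.toLp 2 (P.stableGraph f x y.snd, y.snd),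
    ⟨⟨by rw [real_inner_comm]; exact hs, hy.2⟩, rfl⟩,
    WithLp.toLp 2 (y.fst - P.stableGraph f x y.snd, 0), ⟨⟨?_, inner_zero_left _⟩, rfl⟩, ?_⟩
  · change ⟪y.fst - P.stableGraph f x y.snd, _⟫ = 0
    rw [inner_sub_left, hy.1, real_inner_comm, hs, sub_zero]
  · exact phase_ext (add_sub_cancel _ _) (add_zero _)

/-- The inclusion of displacements into the space of pairs. -/
def inclFst (d : ℕ) : E d →L[ℝ] X d :=
  (WithLp.prodContinuousLinearEquiv 2 ℝ (E d) (E d)).symm.toContinuousLinearMap ∘L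
    ContinuousLinearMap.inl ℝ (E d) (E d)

/-- The inclusion of velocity variations into the space of pairs. -/
def inclSnd (d : ℕ) : E d →L[ℝ] X d :=
  (WithLp.prodContinuousLinearEquiv 2 ℝ (E d) (E d)).symm.toContinuousLinearMap ∘L
    ContinuousLinearMap.inr ℝ (E d) (E d)

lemma continuousOn_starProjection_stableSpace (hΛ : P.IsInvariant f Λ)
    (hf : IsContractingReflectionLaw f) :
    ContinuousOn (fun x => (P.stableSpace f x).starProjection) Λ := by
  set S := WithLp.sndL 2 ℝ (E d) (E d)
  have hp : ContinuousOn (fun x : X d => perp x.snd ∘L S) Λ :=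
    (continuous_perp.comp continuous_velocity).continuousOn.clm_comp continuousOn_const
  have hT : ContinuousOn (fun x : X d => inclFst d ∘L P.stableGraph f x ∘L perp x.snd ∘L S +
      inclSnd d ∘L perp x.snd ∘L S) Λ :=
    (continuousOn_const.clm_comp ((continuousOn_stableGraph hΛ hf).clm_comp hp)).add
      (continuousOn_const.clm_comp hp)
  have hfst : ∀ x y : X d, ((inclFst d ∘L P.stableGraph f x ∘L perp x.snd ∘L S +
      inclSnd d ∘L perp x.snd ∘L S) y).fst = P.stableGraph f x (perp x.snd y.snd) :=
    fun x y => add_zero _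
  have hsnd : ∀ x y : X d, ((inclFst d ∘L P.stableGraph f x ∘L perp x.snd ∘L S +
      inclSnd d ∘L perp x.snd ∘L S) y).snd = perp x.snd y.snd := fun x y => zero_add _
  refine continuousOn_starProjection hT (fun x hx y => ?_) (fun x hx y hy => ?_)
  · refine ⟨⟨?_, ?_⟩, ?_⟩
    · rw [hfst, real_inner_comm, inner_stableGraph hΛ hf hx]
    · rw [hsnd, real_inner_comm, inner_perp_self (norm_snd (IsInvariant.mem_M' hΛ hx).1)]
    · rw [hfst, hsnd]
  · have h1 : perp x.snd y.snd = y.snd :=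
      perp_of_inner_eq_zero (by rw [real_inner_comm]; exact hy.1.2)
    exact phase_ext (by rw [hfst, h1, hy.2]) (by rw [hsnd, h1])

lemma continuousOn_starProjection_unstableSpace (hΛ : P.IsInvariant f Λ) :
    ContinuousOn (fun x => (P.unstableSpace x).starProjection) Λ := by
  set F := WithLp.fstL 2 ℝ (E d) (E d)
  have hn : ContinuousOn (fun x : X d => P.normalAt x.fst) Λ := fun x hx =>
    (continuousWithinAt_normalAt (IsInvariant.mem_M' hΛ hx)).mono
      fun y hy => (IsInvariant.mem_M' hΛ hy).1
  have hT : ContinuousOn (fun x : X d => inclFst d ∘L perp (P.normalAt x.fst) ∘L F) Λ :=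
    continuousOn_const.clm_comp
      ((continuous_perp.comp_continuousOn hn).clm_comp continuousOn_const)
  refine continuousOn_starProjection hT (fun x hx y => ?_) (fun x hx y hy => ?_)
  · obtain ⟨i, hi⟩ := exists_normalAt_eq (IsInvariant.mem_M' hΛ hx).1
    refine ⟨⟨?_, inner_zero_left _⟩, rfl⟩
    rw [real_inner_comm]
    exact inner_perp_self (by rw [hi, P.norm_normal]) y.fst
  · refine phase_ext ?_ hy.2.symm
    exact perp_of_inner_eq_zero (by rw [real_inner_comm]; exact hy.1.1)

lemma backProj_velocity {x : X d} (hx : x ∈ P.M) : P.backProj x x.snd = 0 :=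
  oblique_self (inner_normalAt_pos hx).ne'

lemma backProj_of_mem_tangent {x y : X d} (hy : y ∈ P.tangent x) :
    P.backProj x y.fst = y.fst :=
  oblique_of_inner_eq_zero (by rw [real_inner_comm]; exact hy.1)

/-- The derivative of the billiard map carries exactly the stable subspace into the stable
subspace. -/
lemma mapDeriv_mem_stableSpace_iff (hΛ : P.IsInvariant f Λ) (hf : IsContractingReflectionLaw f)
    {x y : X d} (hx : x ∈ Λ) (hy : y ∈ P.tangent x) :
    P.mapDeriv f x y ∈ P.stableSpace f (P.billiardMap f x) ↔ y ∈ P.stableSpace f x := by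
  have hxM := IsInvariant.mem_M' hΛ hx
  obtain ⟨i, j, h⟩ := P.exists_hits hxM
  have hv : P.velContraction f x y.snd = P.velDeriv f x y.snd :=
    velContraction_eq (by rw [real_inner_comm]; exact hy.2)
  have hinv := stableGraph_apply hΛ hf hx y.snd
  have hs := inner_stableGraph hΛ hf (IsInvariant.map_mem hΛ hx) (P.velContraction f x y.snd)
  have hn : P.normalAt (P.billiardMap f x).fst = P.normal j := h.normalAt_nextPoint
  rw [hn] at hs
  rw [mem_stableSpace_iff, mem_stableSpace_iff, mapDeriv_fst, mapDeriv_snd,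
    h.normalAt_nextPoint, ← hv]
  set z := P.stableGraph f (P.billiardMap f x) (P.velContraction f x y.snd)
  constructor
  · rintro ⟨-, heq⟩
    refine ⟨hy, ?_⟩
    obtain ⟨c, hc⟩ := exists_oblique_eq x.snd (P.normal j) (y.fst + P.flightTime x • y.snd)
    rw [hinv, ← heq, hc, add_sub_right_comm, add_sub_cancel_right, map_add, map_smul,
      backProj_velocity hxM.1, smul_zero, add_zero, backProj_of_mem_tangent hy]
  · rintro ⟨-, heq⟩
    refine ⟨mapDeriv_mem_tangent hf hxM, ?_⟩
    obtain ⟨c, hc⟩ := exists_oblique_eq x.snd (P.normalAt x.fst) (z - P.flightTime x • y.snd)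
    rw [heq, hinv, backProj, hc, add_right_comm, sub_add_cancel, map_add, map_smul,
      oblique_self h.inner_neg.ne, smul_zero, add_zero, oblique_of_inner_eq_zero hs]

/-- If the derivative of the billiard map is injective on the tangent space, its velocity part is
onto. -/
lemma exists_velDeriv_eq (hf : IsContractingReflectionLaw f) {x : X d} (hx : x ∈ P.M')
    (hx' : P.billiardMap f x ∈ P.M) (hinj : Set.InjOn (P.mapDeriv f x) (P.tangent x)) {w' : E d}
    (hw' : ⟪w', (P.billiardMap f x).snd⟫ = 0) :
    ∃ w : E d, ⟪w, x.snd⟫ = 0 ∧ P.velDeriv f x w = w' := by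
  obtain ⟨i, j, h⟩ := P.exists_hits hx
  have hmaps : ∀ w ∈ (Submodule.span ℝ {x.snd})ᗮ,
      (P.velDeriv f x).toLinearMap w ∈ (Submodule.span ℝ {(P.billiardMap f x).snd})ᗮ := by
    intro w hw
    rw [Submodule.mem_orthogonal_singleton_iff_inner_right] at hw ⊢
    rw [ContinuousLinearMap.coe_coe, ← velContraction_eq hw]
    exact inner_velContraction hf hx w
  set K := (P.velDeriv f x).toLinearMap.restrict hmaps with hK
  have hKinj : Function.Injective K := by
    rw [injective_iff_map_eq_zero]
    rintro ⟨w, hw⟩ hw0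
    have hw0' : P.velDeriv f x w = 0 := congrArg Subtype.val hw0
    rw [Submodule.mem_orthogonal_singleton_iff_inner_right] at hw
    -- the displacement is chosen so that the derivative annihilates the whole pair
    set y : X d := WithLp.toLp 2 (P.backProj x (-(P.flightTime x • w)), w) with hy
    have hyt : y ∈ P.tangent x :=
      ⟨by rw [real_inner_comm]; exact inner_backProj hx.1 _, by rw [real_inner_comm]; exact hw⟩
    have hy0 : P.mapDeriv f x y = P.mapDeriv f x 0 := by
      rw [map_zero]
      refine phase_ext ?_ hw0'
      obtain ⟨c, hc⟩ := exists_oblique_eq x.snd (P.normalAt x.fst) (-(P.flightTime x • w))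
      rw [mapDeriv_fst, h.normalAt_nextPoint]
      change oblique x.snd (P.normal j) (P.backProj x (-(P.flightTime x • w)) +
        P.flightTime x • w) = 0
      rw [backProj, hc, neg_add_cancel_comm, map_smul, oblique_self h.inner_neg.ne, smul_zero]
    have := hinj hyt (zero_mem _) hy0
    have h2 : w = 0 := congrArg WithLp.snd this
    exact Subtype.ext h2
  have hfin : Module.finrank ℝ (Submodule.span ℝ {x.snd})ᗮ =
      Module.finrank ℝ (Submodule.span ℝ {(P.billiardMap f x).snd})ᗮ := by
    have hne : ∀ {z : X d}, z ∈ P.M → z.snd ≠ 0 := fun hz h0 => by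
      have := norm_snd hz
      rw [h0, norm_zero] at this
      exact zero_ne_one this
    have h1 := Submodule.finrank_add_finrank_orthogonal (Submodule.span ℝ {x.snd})
    have h2 := Submodule.finrank_add_finrank_orthogonal
      (Submodule.span ℝ {(P.billiardMap f x).snd})
    rw [finrank_span_singleton (hne hx.1)] at h1
    rw [finrank_span_singleton (hne hx')] at h2
    omega
  have hKsurj := (LinearMap.injective_iff_surjective_of_finrank_eq_finrank hfin).1 hKinj
  obtain ⟨⟨w, hw⟩, hww⟩ := hKsurj ⟨w', by
    rw [Submodule.mem_orthogonal_singleton_iff_inner_left]; exact hw'⟩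
  rw [Submodule.mem_orthogonal_singleton_iff_inner_left] at hw
  exact ⟨w, hw, congrArg Subtype.val hww⟩

lemma image_stableSpace (hΛ : P.IsInvariant f Λ) (hf : IsContractingReflectionLaw f) {x : X d}
    (hx : x ∈ Λ) (hinj : Set.InjOn (P.mapDeriv f x) (P.tangent x)) :
    P.mapDeriv f x '' (P.stableSpace f x) = P.stableSpace f (P.billiardMap f x) := by
  have hx' := IsInvariant.map_mem hΛ hx
  refine Set.Subset.antisymm ?_ fun y' hy' => ?_
  · rintro _ ⟨y, hy, rfl⟩
    exact (mapDeriv_mem_stableSpace_iff hΛ hf hx hy.1).2 hy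
  · obtain ⟨w, hw, hww⟩ := exists_velDeriv_eq hf (IsInvariant.mem_M' hΛ hx)
      (IsInvariant.mem_M' hΛ hx').1 hinj hy'.1.2
    set y : X d := WithLp.toLp 2 (P.stableGraph f x w, w) with hy
    have hyt : y ∈ P.tangent x :=
      ⟨by rw [real_inner_comm]; exact inner_stableGraph hΛ hf hx w, hw⟩
    have hys : y ∈ P.stableSpace f x := ⟨hyt, rfl⟩
    have h1 := (mapDeriv_mem_stableSpace_iff hΛ hf hx hyt).2 hys
    have h2 : (P.mapDeriv f x y).snd = y'.snd := hww
    exact ⟨y, hys, phase_ext (by rw [h1.2, h2, ← hy'.2]) h2⟩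

lemma image_unstableSpace (hΛ : P.IsInvariant f Λ) (hf : IsContractingReflectionLaw f) {x : X d}
    (hx : x ∈ Λ) :
    P.mapDeriv f x '' (P.unstableSpace x) = P.unstableSpace (P.billiardMap f x) := by
  have hxM := IsInvariant.mem_M' hΛ hx
  refine Set.Subset.antisymm ?_ fun y' hy' => ?_
  · rintro _ ⟨y, hy, rfl⟩
    exact ⟨mapDeriv_mem_tangent hf hxM, by rw [mapDeriv_snd, hy.2, map_zero]⟩
  · obtain ⟨i, j, h⟩ := P.exists_hits hxM
    have hn : P.normalAt (P.billiardMap f x).fst = P.normal j := h.normalAt_nextPoint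
    have h1 := hy'.1.1
    rw [hn, real_inner_comm] at h1
    refine ⟨WithLp.toLp 2 (P.backProj x y'.fst, 0), ⟨⟨?_, inner_zero_left _⟩, rfl⟩, ?_⟩
    · rw [real_inner_comm]; exact inner_backProj hxM.1 _
    · refine phase_ext ?_ ?_
      · rw [mapDeriv_fst, h.normalAt_nextPoint]
        change oblique x.snd (P.normal j) (P.backProj x y'.fst + P.flightTime x • (0 : E d)) = _
        rw [smul_zero, add_zero, backProj, oblique_oblique h.inner_neg.ne,
          oblique_of_inner_eq_zero h1]
      · rw [hy'.2, mapDeriv_snd]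
        exact map_zero _

lemma norm_le_of_mem_stableSpace {x y : X d} (hy : y ∈ P.stableSpace f x) :
    ‖y‖ ≤ (‖P.stableGraph f x‖ + 1) * ‖y.snd‖ := by
  have h1 : ‖y.fst‖ ≤ ‖P.stableGraph f x‖ * ‖y.snd‖ := by
    rw [hy.2]; exact (P.stableGraph f x).le_opNorm _
  have h2 := WithLp.prod_norm_sq_eq_of_L2 y
  refine le_of_sq_le_sq ?_ (by positivity)
  have := norm_nonneg y.fst
  have := norm_nonneg y.snd
  calc ‖y‖ ^ 2 ≤ (‖y.fst‖ + ‖y.snd‖) ^ 2 := by rw [h2]; nlinarith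
    _ ≤ _ := by gcongr; linarith

lemma orbitDeriv_mem_stableSpace (hΛ : P.IsInvariant f Λ) (hf : IsContractingReflectionLaw f)
    {x y : X d} (hx : x ∈ Λ) (hy : y ∈ P.stableSpace f x) (n : ℕ) :
    P.orbitDeriv f n x y ∈ P.stableSpace f ((P.billiardMap f)^[n] x) ∧
      ‖(P.orbitDeriv f n x y).snd‖ ≤ contractionRate f ^ n * ‖y.snd‖ := by
  induction n with
  | zero => exact ⟨hy, by rw [pow_zero, one_mul]; rfl⟩
  | succ n ih =>
    have hxn := IsInvariant.iterate_mem hΛ hx n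
    rw [orbitDeriv_succ, Function.iterate_succ_apply']
    refine ⟨(mapDeriv_mem_stableSpace_iff hΛ hf hxn ih.1.1).2 ih.1, ?_⟩
    rw [mapDeriv_snd, ← velContraction_eq (by rw [real_inner_comm]; exact ih.1.1.2), pow_succ',
      mul_assoc]
    have := hf.contractionRate_pos
    exact (norm_velContraction_le hf (IsInvariant.mem_M' hΛ hxn) _).trans (by gcongr; exact ih.2)

lemma norm_snd_le (y : X d) : ‖y.snd‖ ≤ ‖y‖ := by
  have := WithLp.prod_norm_sq_eq_of_L2 y
  exact le_of_sq_le_sq (by nlinarith [sq_nonneg ‖y.fst‖]) (norm_nonneg y)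

lemma norm_eq_of_snd_eq_zero {y : X d} (hy : y.snd = 0) : ‖y‖ = ‖y.fst‖ := by
  have h := WithLp.prod_norm_sq_eq_of_L2 y
  rw [hy, norm_zero] at h
  exact (sq_eq_sq₀ (norm_nonneg _) (norm_nonneg _)).1 (by linarith)

end Invariant
end Polytope

end PolytopeBilliard

end

open PolytopeBilliard PolytopeBilliard.Polytope in
theorem theorem2p11 (d : ℕ) (hd : 2 ≤ d) (P : PolytopeBilliard.Polytope d) (hP : P.IsSpanning)
    (f : ℝ → ℝ) (hf : PolytopeBilliard.IsContractingReflectionLaw f) :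
    ∃ σ lam C : ℝ, 1 < σ ∧
      ∀ Λ : Set (PolytopeBilliard.X d), P.IsInvariant f Λ →
        ∀ τ : ℕ, 1 ≤ τ → (∀ x ∈ Λ, P.escapingTime f x ≤ (τ : ℕ∞)) →
          P.IsUniformlyHyperbolicOn f Λ C lam (σ ^ (1 / (τ : ℝ))) := by
  obtain ⟨s, hs, Hexp⟩ := exists_expansion P hf
  obtain ⟨R, hR0, hR⟩ := exists_flightTime_le P
  have hκ : 0 < minCos f := hf.cos_lawRate_pos
  have hl0 := hf.contractionRate_pos
  have hl1 := hf.contractionRate_lt_one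
  have hl1' : 0 < 1 - contractionRate f := by linarith
  -- `s` is the growth rate of squared lengths
  set σ := √s with hσ
  have hσ1 : 1 < σ := by rw [hσ]; exact Real.lt_sqrt_of_sq_lt (by simpa using hs)
  have hσ0 : 0 < σ := by linarith
  have hσs : σ ^ 2 = s := Real.sq_sqrt (by linarith)
  set B := R / minCos f * (1 - contractionRate f)⁻¹ with hB
  have hB0 : 0 < B := by positivity
  have hq0 : 0 < σ / minCos f := by positivity
  refine ⟨σ, contractionRate f, (B + 1) + σ / minCos f, hσ1, fun Λ hΛ τ hτ hesc => ?_⟩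
  have hτ0 : (0 : ℝ) < τ := by exact_mod_cast hτ
  set ρ := σ ^ (1 / (τ : ℝ)) with hρ
  have hρ1 : 1 < ρ := Real.one_lt_rpow hσ1 (by positivity)
  have hρτ : ρ ^ τ = σ := by
    rw [hρ, one_div, Real.rpow_inv_natCast_pow hσ0.le (by omega)]
  refine ⟨by positivity, hl0, hl1, hρ1, fun x hx n => ?_, P.stableSpace f, P.unstableSpace,
    fun x hx => ⟨disjoint_stableSpace_unstableSpace x, stableSpace_sup_unstableSpace hΛ hf hx⟩,
    continuousOn_starProjection_stableSpace hΛ hf, continuousOn_starProjection_unstableSpace hΛ,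
    fun x hx => ?_, fun x hx n _ y hy => ?_, fun x hx n _ y hy => ?_⟩
  · exact (hasFDerivWithinAt_iterate hf (IsInvariant.mem_MPlus hΛ hx).2 n).1.differentiableWithinAt
  · have hD : ∀ y ∈ P.tangent x, P.DPhi f 1 x y = P.mapDeriv f x y := fun y hy =>
      DPhi_one_apply hf (IsInvariant.mem_MPlus hΛ hx) hy
    refine ⟨?_, fun hinj => ?_, ?_⟩
    · ext y
      constructor
      · rintro ⟨hy, hy'⟩
        rw [hD y hy] at hy'
        exact (mapDeriv_mem_stableSpace_iff hΛ hf hx hy).1 hy'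
      · intro hy
        refine ⟨hy.1, ?_⟩
        rw [hD y hy.1]
        exact (mapDeriv_mem_stableSpace_iff hΛ hf hx hy.1).2 hy
    · have hinj' : Set.InjOn (P.mapDeriv f x) (P.tangent x) :=
        hinj.congr fun y hy => hD y hy
      rw [← image_stableSpace hΛ hf hx hinj']
      exact Set.image_congr fun y hy => hD y hy.1
    · rw [← image_unstableSpace hΛ hf hx]
      exact Set.image_congr fun y hy => hD y hy.1
  · rw [DPhi_apply hf (IsInvariant.mem_MPlus hΛ hx) n hy.1]
    obtain ⟨h1, h2⟩ := orbitDeriv_mem_stableSpace hΛ hf hx hy n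
    have h3 := norm_le_of_mem_stableSpace h1
    have h4 := norm_stableGraph_le hΛ hf hR0 hR (IsInvariant.iterate_mem hΛ hx n)
    have h5 := norm_snd_le y
    calc ‖P.orbitDeriv f n x y‖ ≤ _ := h3
      _ ≤ (B + 1) * (contractionRate f ^ n * ‖y.snd‖) := by gcongr
      -- the constant has one summand for each of the two estimates
      _ ≤ ((B + 1) + σ / minCos f) * (contractionRate f ^ n * ‖y‖) :=
        mul_le_mul (by linarith) (by gcongr) (by positivity) (by positivity)
      _ = _ := by ring
  · have hxM := IsInvariant.mem_MPlus hΛ hx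
    rw [DPhi_apply hf hxM n hy.1, norm_eq_of_snd_eq_zero hy.2,
      norm_eq_of_snd_eq_zero (orbitDeriv_snd_eq_zero hy.2 n)]
    obtain ⟨i, hi⟩ := exists_normalAt_eq hxM.1
    have h1 := Hexp x hxM τ hτ (hesc x hx) y hy.1 hy.2 n
    have h2 := mul_norm_sq_le_transverse (by rw [hi, P.norm_normal]) (norm_snd hxM.1) hκ.le
      (IsInvariant.minCos_le hΛ hf hx) (u := y.fst) (by rw [real_inner_comm]; exact hy.1.1)
    have h3 : σ ^ (n / τ) * (minCos f * ‖y.fst‖) ≤ ‖(P.orbitDeriv f n x y).fst‖ := by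
      refine le_of_sq_le_sq ?_ (norm_nonneg _)
      calc (σ ^ (n / τ) * (minCos f * ‖y.fst‖)) ^ 2
          = s ^ (n / τ) * (minCos f ^ 2 * ‖y.fst‖ ^ 2) := by
            rw [mul_pow, mul_pow, ← pow_mul, mul_comm (n / τ) 2, pow_mul, hσs]
        _ ≤ s ^ (n / τ) * transverse y.fst x.snd := by gcongr
        _ ≤ _ := h1
    -- an incomplete window of length less than `τ` costs at most one factor `σ`
    have h4 : ρ ^ n ≤ σ * σ ^ (n / τ) := by
      rw [← pow_succ', ← hρτ, ← pow_mul]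
      exact pow_le_pow_right₀ hρ1.le (Nat.lt_mul_div_succ n (by omega)).le
    have hρn : 0 < ρ ^ n := by positivity
    have h5 : ‖y.fst‖ ≤ σ / minCos f * (ρ ^ n)⁻¹ * ‖(P.orbitDeriv f n x y).fst‖ := by
      rw [div_mul_eq_mul_div, div_mul_eq_mul_div, le_div_iff₀ hκ, mul_right_comm,
        ← div_eq_mul_inv, le_div_iff₀ hρn]
      calc ‖y.fst‖ * minCos f * ρ ^ n ≤ ‖y.fst‖ * minCos f * (σ * σ ^ (n / τ)) := by gcongr
        _ = σ * (σ ^ (n / τ) * (minCos f * ‖y.fst‖)) := by ring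
        _ ≤ σ * ‖(P.orbitDeriv f n x y).fst‖ := by gcongr
    refine h5.trans ?_
    gcongr
    linarith
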